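/- Let $B>1$, $L>0$ and let $k\ge 2$ be an integer. For $x\in\mathbb{R}^{k-1}$ let $\mathrm{rk}_1(x)\le\dots\le\mathrm{rk}_{k-1}(x)$ be its coordinates in increasing order, and put $\mathrm{rk}_0(x)=0$, $\mathrm{rk}_k(x)=1$. Let $\mathcal{D}$ be a \emph{good} probability distribution on $[0,1]^{k-1}$: for $X\sim\mathcal{D}$ and every $0\le i\le k-1$, the gap $\mathrm{rk}_{i+1}(X)-\mathrm{rk}_i(X)$ has a density on $[0,1]$ that is Hölder continuous on $[0,1]$ with some exponent in $(0,1]$. For each $R\in\mathbb{N}$ consider the following fragmentation process. Start with $R$ living sticks of length $L$. At each level every living stick is replaced by $k$ children, obtained by cutting it at the relative positions given by the coordinates of a random vector with law $\mathcal{D}$. Each child is alive with probability $1/k$ and dead otherwise; dead sticks never break again. The vectors of cut points of the sticks and the vectors of alive/dead statuses of the $k$ children of the sticks are all mutually independent, but the statuses of the children of the same stick may depend on one another in an arbitrary way (and their joint law may differ from one parent to another). The processes for different $R$ live on one probability space, with an arbitrary joint law. Let $N_R$ be integers with $N_R\ge\log R$ for all $R$, and let $\{X_i\}$ be the finite collection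 of the lengths of all sticks, dead or alive, present in the $R$-th process after $N_R$ levels. For $s\in[1,B)$ let $$P_R(s)=\frac{\#\{i: S_B(X_i)\le s\}}{\#\{X_i\}},$$ where $S_B(x)=x/B^{\lfloor\log_B x\rfloor}$ is the significand of $x$ in base $B$. Then, as $R\to\infty$, these collections converge to strong Benford behavior base $B$: for every $s\in[1,B)$, $$\mathbb{E}[P_R(s)]\to\log_B s\quad\text{and}\quad \mathrm{Var}[P_R(s)]\to 0.$$ Moreover they do so almost surely: with probability $1$, $P_R(s)\to\log_B s$ for all $s\in[1,B)$. -/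

import Mathlib

open MeasureTheory ProbabilityTheory Filter Topology
open scoped NNReal ENNReal

noncomputable section

namespace StickBreaking

/-! ### Benford behavior -/

/-- The significand `S_B(x) = x / B ^ ⌊log_B x⌋` of a positive real `x` in base `B`. -/
def significand (B x : ℝ) : ℝ := x / B ^ ⌊Real.logb B x⌋

open Classical in
/-- The proportion `P(s)` of members of a finite collection (with multiplicity) whose
significand in base `B` is at most `s`. -/
def proportion (B s : ℝ) (A : Multiset ℝ) : ℝ :=
  ((A.filter fun x => significand B x ≤ s).card : ℝ) / (A.card : ℝ)

/-- A deterministic sequence of finite collections converges to strong Benford behavior. -/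
def ConvergesToBenford (B : ℝ) (A : ℕ → Multiset ℝ) : Prop :=
  ∀ s ∈ Set.Ico 1 B, Tendsto (fun n => proportion B s (A n)) atTop (𝓝 (Real.logb B s))

/-- A sequence of random finite collections converges to strong Benford behavior: the mean of the
proportion tends to `log_B s` and its variance tends to `0`. -/
def RandomConvergesToBenford {Ω : Type*} [MeasurableSpace Ω] (B : ℝ) (μ : Measure Ω)
    (A : ℕ → Ω → Multiset ℝ) : Prop :=
  ∀ s ∈ Set.Ico 1 B,
    Tendsto (fun n => ∫ ω, proportion B s (A n ω) ∂μ) atTop (𝓝 (Real.logb B s)) ∧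
    Tendsto (fun n => variance (fun ω => proportion B s (A n ω)) μ) atTop (𝓝 0)

/-! ### Cut points and good distributions -/

/-- `rank x i` is the `i`-th smallest coordinate of `x` for `1 ≤ i ≤ m`, with the conventions
`rank x 0 = 0` and `rank x i = 1` for `i > m`. -/
def rank {m : ℕ} (x : Fin m → ℝ) (i : ℕ) : ℝ :=
  if i = 0 then 0 else if h : i - 1 < m then x (Tuple.sort x ⟨i - 1, h⟩) else 1

/-- The length of the `i`-th piece (counted from `0`) of the unit stick cut at the coordinates
of `x`. -/
def gap {m : ℕ} (x : Fin m → ℝ) (i : ℕ) : ℝ := rank x (i + 1) - rank x i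

/-- A distribution of `m` cut points is good if it lives on `[0,1]^m` and each of the `m + 1`
gaps has a density with respect to Lebesgue measure on `[0,1]` that is Hölder continuous
on `[0,1]`. -/
def IsGood {m : ℕ} (D : Measure (Fin m → ℝ)) : Prop :=
  D (Set.Icc 0 1)ᶜ = 0 ∧
  ∀ i ≤ m, ∃ (f : ℝ → ℝ) (C α : ℝ≥0), 0 < α ∧ α ≤ 1 ∧ HolderOnWith C α f (Set.Icc 0 1) ∧
    (∀ x ∈ Set.Icc (0 : ℝ) 1, 0 ≤ f x) ∧
    D.map (fun x => gap x i) =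
      (volume.restrict (Set.Icc 0 1)).withDensity (fun x => ENNReal.ofReal (f x))

/-! ### The fragmentation process -/

/-- Labels of sticks: the initial stick it comes from, and the positions (most recent first) of
its ancestors and itself among the `k` children of their respective parents. -/
abbrev Stick (R k : ℕ) : Type := Fin R × List (Fin k)

/-- The stick `v`, when it breaks, is cut at the relative positions `cut v`. -/
def stickLength {R k : ℕ} (L : ℝ) (cut : Stick R k → Fin (k - 1) → ℝ) : Stick R k → ℝ
  | (_, []) => L
  | (j, i :: v) => stickLength L cut (j, v) * gap (cut (j, v)) i

/-- Initial sticks are alive; `status v i` says whether the `i`-th child of `v` is alive. -/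
def IsAlive {R k : ℕ} (status : Stick R k → Fin k → Bool) : Stick R k → Prop
  | (_, []) => True
  | (j, i :: v) => status (j, v) i = true

open Classical in
/-- The sticks, dead or alive, present after `N` levels: at each level every living stick is
replaced by its `k` children, and dead sticks stay as they are. -/
def sticksAfter {R k : ℕ} (status : Stick R k → Fin k → Bool) : ℕ → Finset (Stick R k)
  | 0 => Finset.univ.image fun j => (j, [])
  | N + 1 => (sticksAfter status N).biUnion fun v =>
      if IsAlive status v then Finset.univ.image fun i => (v.1, i :: v.2) else {v}

/-- The collection of the lengths of all sticks present after `N` levels. -/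
def lengthsAfter {R k : ℕ} (L : ℝ) (cut : Stick R k → Fin (k - 1) → ℝ)
    (status : Stick R k → Fin k → Bool) (N : ℕ) : Multiset ℝ :=
  (sticksAfter status N).val.map (stickLength L cut)

/-- The random data driving a fragmentation process started from `R` sticks. The cut points of
every stick have law `D`; each child is alive with probability `r`; and all the cut-point vectors
and all the vectors of statuses of siblings are mutually independent. Nothing is assumed on the
joint law of the statuses of siblings, which may also differ from one parent to another. -/
structure IsFragmentation {Ω : Type*} [MeasurableSpace Ω] (μ : Measure Ω) {R k : ℕ}
    (D : Measure (Fin (k - 1) → ℝ)) (r : ℝ) (cut : Stick R k → Ω → Fin (k - 1) → ℝ)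
    (status : Stick R k → Ω → Fin k → Bool) : Prop where
  measurable_cut : ∀ v, Measurable (cut v)
  measurable_status : ∀ v, Measurable (status v)
  law_cut : ∀ v, μ.map (cut v) = D
  prob_alive : ∀ v i, μ {ω | status v ω i = true} = ENNReal.ofReal r
  indep_sticks : iIndepFun (fun v ω => (cut v ω, status v ω)) μ
  indep_cut_status : ∀ v, IndepFun (cut v) (status v) μ

end StickBreaking

end

namespace StickBreaking

/-! ### An exponential moment bound for martingale-like sums -/

/-! Fix a nonzero integer `n` and the character `exp (2πi n log_B x)`. By Weyl's criterion it
suffices that its mean over the collection tends to `0` almost surely, for each `n`. The character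
of a stick length is a unimodular constant times the product, along the branch, of the characters of
the gaps. Since a gap has a density, each factor has mean of modulus less than `1`
(`norm_gapMean_lt_one`), hence at most some `ρ < 1` over the `k` positions.

The set `V` of sticks present depends on the statuses only, which are independent of the cuts, so
`V` may be frozen. Replace the last `m` factors of each branch by their means, one at a time
(`norm_sum_pathProd_le`). Sticks of depth at least `m` then contribute at most `ρ ^ m` each. Each of
the `m` replacement errors, grouped by ancestor `u`, is a sum of terms (product of weights above
`u`) × (bounded centered function of the cut of `u`), that is, of martingale differences. An
Azuma-type estimate (`lintegral_exp_sum_le`) makes it `o(|V|)` outside an event of probability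
exponentially small in `|V| ≥ R`.

There remain the sticks of depth less than `m`, at most a constant times `R`. They are negligible
because `|V| / R → ∞`: the branching is critical, so an initial stick has on average one living
descendant in each generation, and each break adds at least one stick. Over `M` generations the `R`
independent trees thus give `|V| > R M / 2` outside an exponentially small event
(`exists_measure_sum_aliveCount_le`).

All these probabilities are summable in `R`, so the first Borel–Cantelli lemma applies whatever the
joint law of the processes. Means and variances follow by dominated convergence. -/

lemma integral_exp_re_le {β : Type*} [MeasurableSpace β] {ν : Measure β} [IsProbabilityMeasure ν]
    {H : β → ℂ} (hH : Measurable H) {c : ℝ} (hc : ∀ᵐ y ∂ν, ‖H y‖ ≤ c) (h0 : ∫ y, H y ∂ν = 0)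
    {z : ℂ} (hz : ‖z‖ ≤ 1) :
    ∫⁻ y, ENNReal.ofReal (Real.exp (z * H y).re) ∂ν ≤ ENNReal.ofReal (Real.exp (c ^ 2 / 2)) := by
  have hint : Integrable H ν := Integrable.of_bound hH.aestronglyMeasurable c hc
  have hbd : ∀ᵐ y ∂ν, |(z * H y).re| ≤ c := by
    filter_upwards [hc] with y hy
    refine (Complex.abs_re_le_norm _).trans ?_
    rw [norm_mul]
    have := mul_le_mul hz hy (norm_nonneg _) zero_le_one
    linarith
  have hm : Measurable fun y => (z * H y).re := Complex.measurable_re.comp (hH.const_mul z)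
  have hz0 : ∫ y, (z * H y).re ∂ν = 0 := by
    have : ∫ y, (z * H y).re ∂ν = (∫ y, z * H y ∂ν).re :=
      integral_re (hint.const_mul z)
    rw [this, integral_const_mul, h0, mul_zero, Complex.zero_re]
  -- Hoeffding's lemma on `[-c, c]`: half the width is `c`, so the variance proxy is `c ^ 2`.
  have hsub := hasSubgaussianMGF_of_mem_Icc_of_integral_eq_zero (a := -c) (b := c) hm.aemeasurable
    (hbd.mono fun y hy => abs_le.mp hy) hz0
  have hle := hsub.mgf_le 1
  have hcc : (((‖c - -c‖₊ / 2) ^ 2 : ℝ≥0) : ℝ) * 1 ^ 2 / 2 = c ^ 2 / 2 := by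
    push_cast
    rw [Real.norm_eq_abs, div_pow, sq_abs]
    ring
  rw [hcc] at hle
  rw [← ofReal_integral_eq_lintegral_ofReal _ (ae_of_all _ fun y => (Real.exp_pos _).le)]
  · refine ENNReal.ofReal_le_ofReal ?_
    simpa [mgf] using hle
  · simpa using hsub.integrable_exp_mul 1

/-- One step of Azuma's inequality: by independence `Y` can be integrated first, with `(g, a)`
frozen. In the iteration the weight `g` carries the exponential of the earlier terms together with
the indicator of an event. -/
lemma lintegral_mul_exp_re_le {Ω β : Type*} [MeasurableSpace Ω] [MeasurableSpace β]
    {μ : Measure Ω} [IsProbabilityMeasure μ] {Y : Ω → β} (hY : Measurable Y) {g : Ω → ℝ≥0∞}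
    (hg : Measurable g) {a : Ω → ℂ} (ha : Measurable a) (ha1 : ∀ ω, ‖a ω‖ ≤ 1)
    (hind : IndepFun (fun ω => (g ω, a ω)) Y μ) {H : β → ℂ} (hH : Measurable H) {c : ℝ}
    (hc : ∀ ω, ‖H (Y ω)‖ ≤ c) (h0 : ∫ ω, H (Y ω) ∂μ = 0) :
    ∫⁻ ω, g ω * ENNReal.ofReal (Real.exp (a ω * H (Y ω)).re) ∂μ ≤
      ENNReal.ofReal (Real.exp (c ^ 2 / 2)) * ∫⁻ ω, g ω ∂μ := by
  have hga : Measurable fun ω => (g ω, a ω) := hg.prodMk ha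
  have hmap := (indepFun_iff_map_prod_eq_prod_map_map hga.aemeasurable hY.aemeasurable).mp hind
  have : IsProbabilityMeasure (μ.map Y) := Measure.isProbabilityMeasure_map hY.aemeasurable
  have : IsProbabilityMeasure (μ.map fun ω => (g ω, a ω)) :=
    Measure.isProbabilityMeasure_map hga.aemeasurable
  have hc' : ∀ᵐ y ∂(μ.map Y), ‖H y‖ ≤ c :=
    (ae_map_iff hY.aemeasurable (measurableSet_le hH.norm measurable_const)).mpr (ae_of_all _ hc)
  set Φ : (ℝ≥0∞ × ℂ) × β → ℝ≥0∞ :=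
    fun p => p.1.1 * ENNReal.ofReal (Real.exp (p.1.2 * H p.2).re) with hΦ
  have hΦm : Measurable Φ := by
    have h1 : Measurable fun p : (ℝ≥0∞ × ℂ) × β => p.1.2 * H p.2 := by fun_prop
    exact measurable_fst.fst.mul (Complex.measurable_re.comp h1).exp.ennreal_ofReal
  have e1 : ∫⁻ ω, g ω * ENNReal.ofReal (Real.exp (a ω * H (Y ω)).re) ∂μ =
      ∫⁻ p, Φ p ∂(μ.map fun ω => ((g ω, a ω), Y ω)) := by
    rw [lintegral_map hΦm (hga.prodMk hY)]
  rw [e1, hmap, lintegral_prod _ hΦm.aemeasurable, lintegral_map hΦm.lintegral_prod_right' hga,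
    ← lintegral_const_mul _ hg]
  refine lintegral_mono fun ω => ?_
  simp only [hΦ]
  rw [lintegral_const_mul, mul_comm]
  · refine mul_le_mul_left (integral_exp_re_le hH hc' ?_ (ha1 ω)) _
    rwa [integral_map hY.aemeasurable hH.aestronglyMeasurable]
  · exact (Complex.measurable_re.comp (hH.const_mul _)).exp.ennreal_ofReal

/-- Exponential moments of a sum of bounded terms `a u * H u (Y u)` where, in the order given by
`d`, each `Y u` is independent of `a u` and of the earlier terms, and `H u (Y u)` is centered. -/
lemma lintegral_exp_sum_le {Ω β ι : Type*} [mΩ : MeasurableSpace Ω] [mβ : MeasurableSpace β]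
    {μ : Measure Ω} [IsProbabilityMeasure μ] {Y : ι → Ω → β} (hY : ∀ u, Measurable (Y u))
    {g : Ω → ℝ≥0∞} {a : ι → Ω → ℂ} (ha1 : ∀ u ω, ‖a u ω‖ ≤ 1)
    {H : ι → β → ℂ} (hH : ∀ u, Measurable (H u)) {c : ℝ} (hc : ∀ u ω, ‖H u (Y u ω)‖ ≤ c)
    (h0 : ∀ u, ∫ ω, H u (Y u ω) ∂μ = 0) (d : ι → ℕ) (m : ι → MeasurableSpace Ω)
    (hm : ∀ u, m u ≤ mΩ)
    (hind : ∀ u, Indep (m u) (mβ.comap (Y u)) μ) (hgm : ∀ u, Measurable[m u] g)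
    (ham : ∀ u, Measurable[m u] (a u)) (U : Finset ι)
    (hprev : ∀ u, ∀ w ∈ U, w ≠ u → d w ≤ d u → Measurable[m u] (a w) ∧ Measurable[m u] (Y w)) :
    ∫⁻ ω, g ω * ENNReal.ofReal (Real.exp (∑ u ∈ U, a u ω * H u (Y u ω)).re) ∂μ ≤
      ENNReal.ofReal (Real.exp (U.card * (c ^ 2 / 2))) * ∫⁻ ω, g ω ∂μ := by
  classical
  -- Removing an index with `d` maximal makes all remaining terms measurable for its `m u`, so they
  -- can be absorbed into the weight.
  induction U using Finset.induction_on_max_value d with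
  | empty => simp
  | insert u U hu hmax ih =>
    have hsum : Measurable[m u] fun ω => ∑ w ∈ U, a w ω * H w (Y w ω) := by
      refine @Finset.measurable_fun_sum _ _ _ _ _ _ (m u) _ _ fun w hw => ?_
      have h := hprev u w (Finset.mem_insert_of_mem hw) (fun h => hu (h ▸ hw)) (hmax w hw)
      exact h.1.mul ((hH w).comp h.2)
    have hG : Measurable[m u] fun ω =>
        g ω * ENNReal.ofReal (Real.exp (∑ w ∈ U, a w ω * H w (Y w ω)).re) :=
      (hgm u).mul (Complex.measurable_re.comp hsum).exp.ennreal_ofReal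
    have hindep : IndepFun (fun ω =>
        (g ω * ENNReal.ofReal (Real.exp (∑ w ∈ U, a w ω * H w (Y w ω)).re), a u ω)) (Y u) μ :=
      indep_of_indep_of_le_left (hind u) (hG.prodMk (ham u)).comap_le
    have key := lintegral_mul_exp_re_le (hY u) (hG.mono (hm u) le_rfl)
      ((ham u).mono (hm u) le_rfl) (ha1 u) hindep (hH u) (hc u) (h0 u)
    have ih' := ih fun v w hw => hprev v w (Finset.mem_insert_of_mem hw)
    calc _ = ∫⁻ ω, g ω * ENNReal.ofReal (Real.exp (∑ w ∈ U, a w ω * H w (Y w ω)).re) *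
          ENNReal.ofReal (Real.exp (a u ω * H u (Y u ω)).re) ∂μ := by
          refine lintegral_congr fun ω => ?_
          rw [Finset.sum_insert hu, Complex.add_re, add_comm, Real.exp_add,
            ENNReal.ofReal_mul (Real.exp_pos _).le, mul_assoc]
      _ ≤ _ := key
      _ ≤ ENNReal.ofReal (Real.exp (c ^ 2 / 2)) *
          (ENNReal.ofReal (Real.exp (U.card * (c ^ 2 / 2))) * ∫⁻ ω, g ω ∂μ) := by gcongr
      _ = _ := by
          rw [← mul_assoc, ← ENNReal.ofReal_mul (Real.exp_pos _).le, ← Real.exp_add,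
            Finset.card_insert_of_notMem hu]
          push_cast
          ring_nf

/-- Chernoff's bound, localized to an event whose indicator is the weight. -/
lemma measure_inter_le_of_lintegral_exp_le {Ω : Type*} [MeasurableSpace Ω] {μ : Measure Ω}
    {A : Set Ω} (hA : MeasurableSet A) {X : Ω → ℝ} (hX : Measurable X) {t b : ℝ}
    (h : ∫⁻ ω, A.indicator 1 ω * ENNReal.ofReal (Real.exp (X ω)) ∂μ ≤
      ENNReal.ofReal (Real.exp b) * μ A) :
    μ (A ∩ {ω | t ≤ X ω}) ≤ ENNReal.ofReal (Real.exp (b - t)) * μ A := by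
  have hset : MeasurableSet (A ∩ {ω | t ≤ X ω}) := hA.inter (measurableSet_le measurable_const hX)
  have h1 : ENNReal.ofReal (Real.exp t) * μ (A ∩ {ω | t ≤ X ω}) ≤
      ENNReal.ofReal (Real.exp b) * μ A := by
    refine le_trans ?_ h
    rw [← lintegral_indicator_const hset]
    refine lintegral_mono fun ω => ?_
    by_cases hω : ω ∈ A ∩ {ω | t ≤ X ω}
    · rw [Set.indicator_of_mem hω, Set.indicator_of_mem hω.1, Pi.one_apply, one_mul]
      exact ENNReal.ofReal_le_ofReal (Real.exp_le_exp.mpr hω.2)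
    · rw [Set.indicator_of_notMem hω]
      exact zero_le
  have h2 : ENNReal.ofReal (Real.exp (-t)) * ENNReal.ofReal (Real.exp t) = 1 := by
    rw [← ENNReal.ofReal_mul (Real.exp_pos _).le, ← Real.exp_add]
    simp
  calc _ = ENNReal.ofReal (Real.exp (-t)) *
        (ENNReal.ofReal (Real.exp t) * μ (A ∩ {ω | t ≤ X ω})) := by rw [← mul_assoc, h2, one_mul]
    _ ≤ ENNReal.ofReal (Real.exp (-t)) * (ENNReal.ofReal (Real.exp b) * μ A) := by gcongr
    _ = _ := by
        rw [← mul_assoc, ← ENNReal.ofReal_mul (Real.exp_pos _).le, ← Real.exp_add]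
        ring_nf

end StickBreaking

namespace StickBreaking

/-! ### Measurability of the gaps -/

/-- Every permutation `σ` making `x ∘ σ` monotone yields the same sorted tuple, so the preimage is a
finite union over `σ` and no measurability of the chosen permutation is needed. -/
lemma measurable_comp_sort {m : ℕ} (i : Fin m) :
    Measurable fun x : Fin m → ℝ => x (Tuple.sort x i) := by
  intro s hs
  have : (fun x : Fin m → ℝ => x (Tuple.sort x i)) ⁻¹' s =
      ⋃ σ : Equiv.Perm (Fin m), {x | Monotone (x ∘ σ)} ∩ {x | x (σ i) ∈ s} := by
    ext x
    simp only [Set.mem_preimage, Set.mem_iUnion, Set.mem_inter_iff, Set.mem_ofPred_eq]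
    constructor
    · exact fun h => ⟨Tuple.sort x, Tuple.monotone_sort x, h⟩
    · rintro ⟨σ, hσ, h⟩
      have := congrFun (Tuple.comp_sort_eq_comp_iff_monotone.mpr hσ) i
      simp only [Function.comp_apply] at this
      rwa [← this]
  rw [this]
  refine MeasurableSet.iUnion fun σ => MeasurableSet.inter ?_ (measurable_pi_apply (σ i) hs)
  have : {x : Fin m → ℝ | Monotone (x ∘ σ)} =
      ⋂ (a : Fin m) (b : Fin m) (_ : a ≤ b), {x | x (σ a) ≤ x (σ b)} := by
    ext x
    simp [Monotone]
  rw [this]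
  exact MeasurableSet.iInter fun a => MeasurableSet.iInter fun b => MeasurableSet.iInter fun _ =>
    measurableSet_le (measurable_pi_apply _) (measurable_pi_apply _)

lemma measurable_rank {m : ℕ} (i : ℕ) : Measurable fun x : Fin m → ℝ => rank x i := by
  unfold rank
  split_ifs
  · exact measurable_const
  · exact measurable_comp_sort _
  · exact measurable_const

lemma measurable_gap {m : ℕ} (i : ℕ) : Measurable fun x : Fin m → ℝ => gap x i :=
  (measurable_rank _).sub (measurable_rank _)

lemma IsGood.map_gap_absolutelyContinuous {m : ℕ} {D : Measure (Fin m → ℝ)} (hD : IsGood D)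
    {i : ℕ} (hi : i ≤ m) : D.map (fun x => gap x i) ≪ volume.restrict (Set.Icc 0 1) := by
  obtain ⟨f, C, α, -, -, -, -, h⟩ := hD.2 i hi
  rw [h]
  exact withDensity_absolutelyContinuous _ _

lemma IsGood.ae_gap_pos {m : ℕ} {D : Measure (Fin m → ℝ)} (hD : IsGood D)
    {i : ℕ} (hi : i ≤ m) : ∀ᵐ x ∂D, 0 < gap x i := by
  refine ae_of_ae_map (measurable_gap i).aemeasurable ?_
  refine (hD.map_gap_absolutelyContinuous hi).ae_le ?_
  have h0 : ∀ᵐ y ∂(volume.restrict (Set.Icc (0 : ℝ) 1)), y ≠ 0 :=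
    (ae_restrict_of_ae (by simp [ae_iff]))
  filter_upwards [h0, ae_restrict_mem measurableSet_Icc] with y hy hy'
  exact lt_of_le_of_ne hy'.1 hy.symm

/-! ### Logarithmic characters -/

/-- The character `x ↦ exp (2 π i n log_B x)` of the multiplicative group of positive reals. -/
noncomputable def logChar (B : ℝ) (n : ℤ) (x : ℝ) : ℂ :=
  fourier n ((Real.logb B x : ℝ) : UnitAddCircle)

lemma norm_logChar (B : ℝ) (n : ℤ) (x : ℝ) : ‖logChar B n x‖ = 1 := by
  rw [logChar, fourier_apply, Circle.norm_coe]

lemma logChar_mul (B : ℝ) (n : ℤ) {x y : ℝ} (hx : x ≠ 0) (hy : y ≠ 0) :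
    logChar B n (x * y) = logChar B n x * logChar B n y := by
  simp only [logChar, Real.logb_mul hx hy, fourier_apply, AddCircle.coe_add, smul_add,
    AddCircle.toCircle_add, Circle.coe_mul]

lemma measurable_logChar (B : ℝ) (n : ℤ) : Measurable (logChar B n) := by
  have h : Continuous fun t : ℝ => fourier n (t : UnitAddCircle) :=
    (map_continuous (fourier n)).comp (AddCircle.continuous_mk' 1)
  exact h.measurable.comp (Real.measurable_log.div_const _)

/-- A nonempty level set is a translate of `(1 / n) ℤ`. -/
lemma countable_fourier_eq {n : ℤ} (hn : n ≠ 0) (c : ℂ) :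
    {t : ℝ | fourier n (t : UnitAddCircle) = c}.Countable := by
  rcases Set.eq_empty_or_nonempty {t : ℝ | fourier n (t : UnitAddCircle) = c} with h | ⟨t₀, ht₀⟩
  · rw [h]
    exact Set.countable_empty
  refine (Set.countable_range fun j : ℤ => t₀ + j / n).mono fun t ht => ?_
  have h : fourier n (t : UnitAddCircle) = fourier n (t₀ : UnitAddCircle) := by
    rw [Set.mem_ofPred_eq] at ht ht₀
    rw [ht, ht₀]
  rw [fourier_coe_apply, fourier_coe_apply, Complex.exp_eq_exp_iff_exists_int] at h
  obtain ⟨j, hj⟩ := h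
  refine ⟨j, ?_⟩
  have hn' : (n : ℝ) ≠ 0 := by exact_mod_cast hn
  have h2 : (2 * Real.pi * Complex.I) * ((n * t : ℝ) : ℂ) =
      (2 * Real.pi * Complex.I) * ((n * t₀ + j : ℝ) : ℂ) := by
    push_cast at hj ⊢
    linear_combination hj
  have h3 := Complex.ofReal_injective (mul_left_cancel₀ Complex.two_pi_I_ne_zero h2)
  field_simp
  linarith

lemma countable_logChar_eq {B : ℝ} (hB : 1 < B) {n : ℤ} (hn : n ≠ 0) (c : ℂ) :
    {x : ℝ | logChar B n x = c}.Countable := by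
  have hC := countable_fourier_eq hn c
  -- `Real.logb B x` depends on `|x|` only, so each logarithm has two preimages; `0`, where the
  -- logarithm is a default value, is added separately.
  refine (((hC.image fun t => B ^ t).union (hC.image fun t => -B ^ t)).union
    (Set.countable_singleton 0)).mono fun x hx => ?_
  rcases eq_or_ne x 0 with h0 | h0
  · exact Or.inr h0
  have habs := Real.rpow_logb_eq_abs (zero_lt_one.trans hB) hB.ne' h0
  rcases lt_or_gt_of_ne h0 with h | h
  · exact Or.inl (Or.inr ⟨Real.logb B x, hx, by simp [habs, abs_of_neg h]⟩)
  · exact Or.inl (Or.inl ⟨Real.logb B x, hx, by simp [habs, abs_of_pos h]⟩)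

/-- The mean of a logarithmic character of the `i`-th gap. -/
noncomputable def gapMean {m : ℕ} (D : Measure (Fin m → ℝ)) (B : ℝ) (n : ℤ) (i : ℕ) : ℂ :=
  ∫ x, logChar B n (gap x i) ∂D

/-- By strict convexity of the disc, a unimodular variable whose mean has modulus `1` is almost
surely constant. The level sets of the character are countable and the law of the gap has a density,
so this is impossible. -/
lemma norm_gapMean_lt_one {m : ℕ} {D : Measure (Fin m → ℝ)} [IsProbabilityMeasure D]
    (hD : IsGood D) {B : ℝ} (hB : 1 < B) {n : ℤ} (hn : n ≠ 0) {i : ℕ} (hi : i ≤ m) :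
    ‖gapMean D B n i‖ < 1 := by
  rcases ae_eq_const_or_norm_integral_lt_of_norm_le_const (μ := D) (C := 1)
    (f := fun x => logChar B n (gap x i)) (ae_of_all _ fun x => (norm_logChar _ _ _).le) with h | h
  · exfalso
    set c := ⨍ x, logChar B n (gap x i) ∂D
    have h0 : volume.restrict (Set.Icc (0 : ℝ) 1) {x | logChar B n x = c} = 0 :=
      Measure.restrict_le_self.absolutelyContinuous
        ((countable_logChar_eq hB hn c).measure_zero _)
    have h1 := hD.map_gap_absolutelyContinuous hi h0
    have hs : MeasurableSet {x | logChar B n x = c} :=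
      measurable_logChar B n (measurableSet_singleton c)
    rw [Measure.map_apply (measurable_gap i) hs] at h1
    have h2 : ∀ᵐ x ∂D, False := by
      filter_upwards [h, measure_eq_zero_iff_ae_notMem.mp h1] with x hx hx'
      exact hx' hx
    exact IsProbabilityMeasure.ne_zero D (ae_eq_bot.mp (eventually_false_iff_eq_bot.mp h2))
  · simpa [gapMean] using h

lemma norm_gapMean_le_one {m : ℕ} (D : Measure (Fin m → ℝ)) [IsProbabilityMeasure D] (B : ℝ)
    (n : ℤ) (i : ℕ) : ‖gapMean D B n i‖ ≤ 1 := by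
  simpa [gapMean] using norm_integral_le_of_norm_le_const (μ := D) (C := 1)
    (f := fun x => logChar B n (gap x i)) (ae_of_all _ fun x => (norm_logChar _ _ _).le)

lemma exists_norm_gapMean_le {k : ℕ} (hk : 1 ≤ k) {D : Measure (Fin (k - 1) → ℝ)}
    [IsProbabilityMeasure D] (hD : IsGood D) {B : ℝ} (hB : 1 < B) {n : ℤ} (hn : n ≠ 0) :
    ∃ ρ : ℝ, 0 ≤ ρ ∧ ρ < 1 ∧ ∀ i : Fin k, ‖gapMean D B n i‖ ≤ ρ := by
  have : Nonempty (Fin k) := ⟨⟨0, hk⟩⟩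
  obtain ⟨i₀, hi₀⟩ := Finite.exists_max fun i : Fin k => ‖gapMean D B n i‖
  exact ⟨_, norm_nonneg _, norm_gapMean_lt_one hD hB hn (by omega), hi₀⟩

end StickBreaking

namespace StickBreaking

/-! ### Weyl's criterion -/

lemma integral_fourier_of_ne_zero {n : ℤ} (hn : n ≠ 0) :
    ∫ t : UnitAddCircle, fourier n t = 0 := by
  have h := congrFun (fourierCoeff_fourier (T := 1) n) 0
  rw [Pi.single_eq_of_ne hn.symm] at h
  have hv : (volume : Measure UnitAddCircle) = AddCircle.haarAddCircle := by
    rw [AddCircle.volume_eq_smul_haarAddCircle]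
    simp
  rw [hv]
  simpa only [fourierCoeff, neg_zero, fourier_zero, one_smul] using h

lemma norm_sum_div_card_le {ι : Type*} (V : Finset ι) {f : ι → ℂ} {c : ℝ} (hc : 0 ≤ c)
    (h : ∀ v ∈ V, ‖f v‖ ≤ c) : ‖(∑ v ∈ V, f v) / (V.card : ℂ)‖ ≤ c := by
  rw [norm_div, Complex.norm_natCast]
  refine div_le_of_le_mul₀ (Nat.cast_nonneg _) hc ?_
  calc _ ≤ ∑ v ∈ V, ‖f v‖ := norm_sum_le _ _
    _ ≤ _ := by
      rw [mul_comm, ← nsmul_eq_mul]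
      exact Finset.sum_le_card_nsmul _ _ _ h

variable {ι : ℕ → Type*}

/-- Both the averages and the integral are linear and contracting for the uniform norm, and
trigonometric polynomials are dense. -/
lemma tendsto_mean_of_fourier {V : ∀ n, Finset (ι n)} (hV : ∀ᶠ n in atTop, (V n).Nonempty)
    {θ : ∀ n, ι n → UnitAddCircle}
    (h : ∀ j : ℤ, j ≠ 0 → Tendsto (fun n => (∑ v ∈ V n, fourier j (θ n v)) / ((V n).card : ℂ))
      atTop (𝓝 0)) (f : C(UnitAddCircle, ℂ)) :
    Tendsto (fun n => (∑ v ∈ V n, f (θ n v)) / ((V n).card : ℂ)) atTop (𝓝 (∫ t, f t)) := by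
  have hint : ∀ f : C(UnitAddCircle, ℂ), Integrable f := fun f =>
    f.continuous.integrable_of_hasCompactSupport (HasCompactSupport.of_compactSpace _)
  have hspan : ∀ p ∈ Submodule.span ℂ (Set.range (fourier (T := 1))),
      Tendsto (fun n => (∑ v ∈ V n, p (θ n v)) / ((V n).card : ℂ)) atTop (𝓝 (∫ t, p t)) := by
    intro p hp
    induction hp using Submodule.span_induction with
    | mem p hp =>
      obtain ⟨j, rfl⟩ := hp
      rcases eq_or_ne j 0 with rfl | hj
      · simp only [fourier_zero, Finset.sum_const, nsmul_eq_mul, mul_one, integral_const]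
        simp only [Measure.real, AddCircle.measure_univ, ENNReal.ofReal_one, ENNReal.toReal_one,
          one_smul]
        refine tendsto_const_nhds.congr' ?_
        filter_upwards [hV] with n hn
        rw [div_self]
        exact_mod_cast hn.card_pos.ne'
      · rw [integral_fourier_of_ne_zero hj]
        exact h j hj
    | zero => simp
    | add p q _ _ hp hq =>
      simp only [ContinuousMap.add_apply, Finset.sum_add_distrib, add_div]
      rw [integral_add (hint p) (hint q)]
      exact hp.add hq
    | smul c p _ hp =>
      simp only [ContinuousMap.smul_apply, smul_eq_mul, ← Finset.mul_sum, mul_div_assoc]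
      rw [integral_const_mul]
      exact hp.const_mul c
  have hf : f ∈ closure (Submodule.span ℂ (Set.range (fourier (T := 1))) :
      Set C(UnitAddCircle, ℂ)) := by
    rw [← Submodule.topologicalClosure_coe, span_fourier_closure_eq_top]
    trivial
  rw [Metric.tendsto_atTop]
  intro ε hε
  obtain ⟨p, hp, hfp⟩ := Metric.mem_closure_iff.mp hf (ε / 3) (by positivity)
  obtain ⟨n₀, hn₀⟩ := Metric.tendsto_atTop.mp (hspan p hp) (ε / 3) (by positivity)
  refine ⟨n₀, fun n hn => ?_⟩
  have hb : ∀ t, ‖f t - p t‖ ≤ ε / 3 := fun t => by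
    rw [dist_eq_norm] at hfp
    exact ((f - p).norm_coe_le_norm t).trans hfp.le
  have h1 : dist ((∑ v ∈ V n, f (θ n v)) / ((V n).card : ℂ))
      ((∑ v ∈ V n, p (θ n v)) / ((V n).card : ℂ)) ≤ ε / 3 := by
    rw [dist_eq_norm, ← sub_div, ← Finset.sum_sub_distrib]
    exact norm_sum_div_card_le _ (by positivity) fun v _ => hb _
  have h2 : dist (∫ t, p t) (∫ t, f t) ≤ ε / 3 := by
    rw [dist_comm, dist_eq_norm, ← integral_sub (hint f) (hint p)]
    have := norm_integral_le_of_norm_le_const (μ := (volume : Measure UnitAddCircle))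
      (ae_of_all _ hb)
    simpa [Measure.real, AddCircle.measure_univ] using this
  have h3 := hn₀ n hn
  have h4 := dist_triangle4 ((∑ v ∈ V n, f (θ n v)) / ((V n).card : ℂ))
    ((∑ v ∈ V n, p (θ n v)) / ((V n).card : ℂ)) (∫ t, p t) (∫ t, f t)
  linarith

open Classical in
-- The portmanteau bound for closed sets, via a Urysohn function between `K` and an open
-- neighborhood of almost the same measure. An upper bound suffices, as it will be applied to an arc
-- and to the closed arc complementary to it.
lemma eventually_card_filter_mem_le {V : ∀ n, Finset (ι n)} {θ : ∀ n, ι n → UnitAddCircle}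
    (h : ∀ f : C(UnitAddCircle, ℂ),
      Tendsto (fun n => (∑ v ∈ V n, f (θ n v)) / ((V n).card : ℂ)) atTop (𝓝 (∫ t, f t)))
    {K : Set UnitAddCircle} (hK : IsClosed K) {ε : ℝ} (hε : 0 < ε) :
    ∀ᶠ n in atTop, (((V n).filter fun v => θ n v ∈ K).card : ℝ) / (V n).card ≤
      volume.real K + ε := by
  obtain ⟨U, hKU, hU, hUε⟩ := Set.exists_isOpen_lt_add (μ := (volume : Measure UnitAddCircle)) K
    (measure_ne_top _ _) (ε := ENNReal.ofReal (ε / 2)) (by simpa using hε)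
  have hUε' : volume.real U ≤ volume.real K + ε / 2 := by
    have := ENNReal.toReal_mono (by finiteness) hUε.le
    rwa [ENNReal.toReal_add (by finiteness) (by finiteness),
      ENNReal.toReal_ofReal (by positivity)] at this
  obtain ⟨f, hf0, hf1, hf⟩ := exists_continuous_zero_one_of_isClosed hU.isClosed_compl hK
    (Set.disjoint_compl_left_iff_subset.mpr hKU)
  have hlim := (h ⟨fun t => (f t : ℂ), by fun_prop⟩)
  simp only [ContinuousMap.coe_mk] at hlim
  have hlim' := (Complex.continuous_re.tendsto _).comp hlim
  have hre : (∫ t : UnitAddCircle, (f t : ℂ)).re = ∫ t, f t := by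
    rw [integral_complex_ofReal, Complex.ofReal_re]
  rw [hre] at hlim'
  have hfint : Integrable f (volume : Measure UnitAddCircle) :=
    f.continuous.integrable_of_hasCompactSupport (HasCompactSupport.of_compactSpace _)
  have hfU : ∫ t, f t ≤ volume.real U := by
    rw [← integral_indicator_one hU.measurableSet]
    refine integral_mono hfint
      ((integrable_indicator_iff hU.measurableSet).mpr (integrable_const 1).integrableOn) fun t => ?_
    by_cases ht : t ∈ U
    · rw [Set.indicator_of_mem ht]
      exact (hf t).2
    · rw [Set.indicator_of_notMem ht, hf0 ht]
      rfl
  filter_upwards [hlim'.eventually_lt_const (show ∫ t, f t < volume.real K + ε by linarith)]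
    with n hn
  refine le_trans ?_ hn.le
  have : ((∑ v ∈ V n, (f (θ n v) : ℂ)) / ((V n).card : ℂ)).re =
      (∑ v ∈ V n, f (θ n v)) / (V n).card := by
    rw [← Complex.ofReal_sum, ← Complex.ofReal_natCast, ← Complex.ofReal_div, Complex.ofReal_re]
  rw [Function.comp_apply, this]
  gcongr
  rw [Finset.card_filter]
  push_cast
  refine Finset.sum_le_sum fun v _ => ?_
  split_ifs with hv
  · exact (hf1 hv).ge
  · exact (hf _).1

lemma volume_real_image_Icc_le {p q : ℝ} (hp : 0 ≤ p) (hpq : p ≤ q) (hq : q ≤ 1) :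
    volume.real ((fun t : ℝ => (t : UnitAddCircle)) '' Set.Icc p q) ≤ q - p := by
  have hcl : IsClosed ((fun t : ℝ => (t : UnitAddCircle)) '' Set.Icc p q) :=
    (isCompact_Icc.image (AddCircle.continuous_mk' 1)).isClosed
  have hmp := UnitAddCircle.measurePreserving_mk 0
  rw [Measure.real, ← hmp.measure_preimage hcl.measurableSet.nullMeasurableSet,
    Measure.restrict_apply (hmp.measurable hcl.measurableSet)]
  -- The extra point `1` occurs when `p = 0`, since `0` and `1` are identified on the circle.
  have hsub : QuotientAddGroup.mk ⁻¹' ((fun t : ℝ => (t : UnitAddCircle)) '' Set.Icc p q) ∩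
      Set.Ioc (0 : ℝ) (0 + 1) ⊆ Set.Icc p q ∪ {1} := by
    rintro t ⟨⟨y, hy, hyt⟩, ht⟩
    have h0 : ((t - y : ℝ) : UnitAddCircle) = 0 := by
      rw [AddCircle.coe_sub]
      exact sub_eq_zero.mpr hyt.symm
    obtain ⟨j, hj⟩ := (AddCircle.coe_eq_zero_iff 1).mp h0
    simp only [zsmul_eq_mul, mul_one] at hj
    have h1 : ((-1 : ℤ) : ℝ) < j := by
      push_cast
      linarith [ht.1, hy.2]
    have h2 : (j : ℝ) ≤ (1 : ℤ) := by
      push_cast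
      linarith [ht.2, hy.1]
    have h1' := Int.cast_lt.mp h1
    have h2' := Int.cast_le.mp h2
    obtain rfl | rfl : j = 0 ∨ j = 1 := by omega
    · left
      have : t = y := by simpa [sub_eq_zero, eq_comm] using hj
      rwa [this]
    · right
      have := ht.2
      push_cast at hj
      simp only [Set.mem_singleton_iff]
      linarith [hy.1]
  have hle : volume (QuotientAddGroup.mk ⁻¹' ((fun t : ℝ => (t : UnitAddCircle)) '' Set.Icc p q) ∩
      Set.Ioc (0 : ℝ) (0 + 1)) ≤ ENNReal.ofReal (q - p) := by
    refine (measure_mono hsub).trans ((measure_union_le _ _).trans ?_)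
    simp
  exact ENNReal.toReal_le_of_le_ofReal (by linarith) hle

lemma significand_le_iff {B : ℝ} (hB : 1 < B) {x : ℝ} (hx : 0 < x) {s : ℝ} (hs : 0 < s) :
    significand B x ≤ s ↔ Int.fract (Real.logb B x) ≤ Real.logb B s := by
  have hB0 : 0 < B := zero_lt_one.trans hB
  have h : significand B x = B ^ Int.fract (Real.logb B x) := by
    rw [significand, Int.fract, Real.rpow_sub hB0, Real.rpow_logb hB0 hB.ne' hx, Real.rpow_intCast]
  rw [h, Real.le_logb_iff_rpow_le hB hs]

/-- Weyl's criterion: a sequence of finite collections of positive reals along which the means of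
the nontrivial logarithmic characters vanish converges to Benford behavior. -/
lemma convergesToBenford_of_logChar {B : ℝ} (hB : 1 < B) {V : ∀ n, Finset (ι n)}
    (hV : ∀ᶠ n in atTop, (V n).Nonempty) {X : ∀ n, ι n → ℝ} (hX : ∀ n, ∀ v, 0 < X n v)
    (h : ∀ j : ℤ, j ≠ 0 →
      Tendsto (fun n => (∑ v ∈ V n, logChar B j (X n v)) / ((V n).card : ℂ)) atTop (𝓝 0)) :
    ConvergesToBenford B fun n => (V n).val.map (X n) := by
  classical
  intro s hs
  set a := Real.logb B s with ha
  have hs0 : 0 < s := zero_lt_one.trans_le hs.1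
  have ha0 : 0 ≤ a := Real.logb_nonneg hB hs.1
  have ha1 : a ≤ 1 := (Real.logb_le_iff_le_rpow hB hs0).mpr (by simpa using hs.2.le)
  set θ : ∀ n, ι n → UnitAddCircle := fun n v =>
    ((Real.logb B (X n v) : ℝ) : UnitAddCircle) with hθ
  have hθf : ∀ n v, θ n v = ((Int.fract (Real.logb B (X n v)) : ℝ) : UnitAddCircle) := by
    intro n v
    rw [hθ, Int.fract, AddCircle.coe_sub]
    have : (((⌊Real.logb B (X n v)⌋ : ℤ) : ℝ) : UnitAddCircle) = 0 :=
      (AddCircle.coe_eq_zero_iff 1).mpr ⟨⌊Real.logb B (X n v)⌋, by simp⟩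
    rw [this, sub_zero]
  have hlim := tendsto_mean_of_fourier hV (θ := θ) h
  have hprop : ∀ n, proportion B s ((V n).val.map (X n)) =
      (((V n).filter fun v => significand B (X n v) ≤ s).card : ℝ) / (V n).card := by
    intro n
    rw [proportion, Multiset.filter_map, Multiset.card_map, Multiset.card_map]
    rfl
  rw [Metric.tendsto_atTop']
  intro ε hε
  have hcl : ∀ p q : ℝ, IsClosed ((fun t : ℝ => (t : UnitAddCircle)) '' Set.Icc p q) :=
    fun p q => (isCompact_Icc.image (AddCircle.continuous_mk' 1)).isClosed
  have hev : ∀ᶠ n in atTop, dist (proportion B s ((V n).val.map (X n))) a < ε := by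
    -- The arc `[0, a]` bounds the proportion from above, and `[a, 1]` bounds the complementary
    -- proportion.
    filter_upwards [hV, eventually_card_filter_mem_le hlim (hcl 0 a) (half_pos hε),
      eventually_card_filter_mem_le hlim (hcl a 1) (half_pos hε)] with n hn h1 h2
    have hc : (0 : ℝ) < (V n).card := by exact_mod_cast hn.card_pos
    have h1' := h1.trans (add_le_add_left (volume_real_image_Icc_le le_rfl ha0 ha1) _)
    have h2' := h2.trans (add_le_add_left (volume_real_image_Icc_le ha0 ha1 le_rfl) _)
    have hup : proportion B s ((V n).val.map (X n)) ≤ a - 0 + ε / 2 := by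
      refine le_trans ?_ h1'
      rw [hprop]
      gcongr with v hv
      intro hvs
      rw [hθf]
      exact ⟨_, ⟨Int.fract_nonneg _, (significand_le_iff hB (hX n v) hs0).mp hvs⟩, rfl⟩
    have hlow : 1 - proportion B s ((V n).val.map (X n)) ≤ 1 - a + ε / 2 := by
      refine le_trans ?_ h2'
      have hsplit := Finset.card_filter_add_card_filter_not (s := V n)
        fun v => significand B (X n v) ≤ s
      have : 1 - proportion B s ((V n).val.map (X n)) =
          (((V n).filter fun v => ¬ significand B (X n v) ≤ s).card : ℝ) / (V n).card := by
        rw [hprop, eq_div_iff hc.ne', sub_mul, div_mul_cancel₀ _ hc.ne', ← hsplit]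
        push_cast
        ring
      rw [this]
      gcongr with v hv
      intro hvs
      rw [hθf]
      rw [significand_le_iff hB (hX n v) hs0, not_le] at hvs
      exact ⟨_, ⟨hvs.le, (Int.fract_lt_one _).le⟩, rfl⟩
    rw [Real.dist_eq, abs_lt]
    constructor <;> linarith
  obtain ⟨n₀, hn₀⟩ := eventually_atTop.mp hev
  exact ⟨n₀, fun n hn => hn₀ n hn.le⟩

end StickBreaking

namespace StickBreaking

/-! ### Products along branches and their telescoping -/

variable {R k : ℕ}

/-- The product of the weights `z` along the branch leading to a stick. -/
def pathProd (z : Stick R k → Fin k → ℂ) : Stick R k → ℂ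
  | (_, []) => 1
  | (j, i :: v) => pathProd z (j, v) * z (j, v) i

/-- The product along a branch with the last `t` weights replaced by the constants `c`. -/
def partialMean (z : Stick R k → Fin k → ℂ) (c : Fin k → ℂ) (t : ℕ) (v : Stick R k) : ℂ :=
  ((v.2.take t).map c).prod * pathProd z (v.1, v.2.drop t)

/-- The coefficient of `pathProd z u` in the sum over `V` of the `t`-th telescoping terms, when the
weights of the children of `u` are `x`. -/
def increment (V : Finset (Stick R k)) (c : Fin k → ℂ) (t : ℕ) (u : Stick R k) (x : Fin k → ℂ) :
    ℂ :=
  ∑ v ∈ V, ∑ i, if (v.1, v.2.drop t) = (u.1, i :: u.2) then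
    ((v.2.take t).map c).prod * (x i - c i) else 0

/-- The words of length less than `m`. -/
noncomputable def shortWords (k m : ℕ) : Finset (List (Fin k)) :=
  (List.finite_length_lt (Fin k) m).toFinset

lemma mem_shortWords {m : ℕ} {l : List (Fin k)} : l ∈ shortWords k m ↔ l.length < m := by
  simp [shortWords]

lemma norm_prod_map_le_pow {c : Fin k → ℂ} {ρ : ℝ} (hc : ∀ i, ‖c i‖ ≤ ρ) (l : List (Fin k)) :
    ‖(l.map c).prod‖ ≤ ρ ^ l.length := by
  induction l with
  | nil => simp
  | cons i l ih =>
    rw [List.map_cons, List.prod_cons, norm_mul, List.length_cons, pow_succ']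
    exact mul_le_mul (hc i) ih (norm_nonneg _) ((norm_nonneg _).trans (hc i))

lemma norm_pathProd_le_one {z : Stick R k → Fin k → ℂ} (hz : ∀ v i, ‖z v i‖ ≤ 1)
    (v : Stick R k) : ‖pathProd z v‖ ≤ 1 := by
  obtain ⟨j, l⟩ := v
  induction l with
  | nil => simp [pathProd]
  | cons i l ih =>
    rw [pathProd, norm_mul]
    exact mul_le_one₀ ih (norm_nonneg _) (hz _ _)

lemma partialMean_zero (z : Stick R k → Fin k → ℂ) (c : Fin k → ℂ) (v : Stick R k) :
    partialMean z c 0 v = pathProd z v := by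
  simp [partialMean]

lemma norm_partialMean_le {z : Stick R k → Fin k → ℂ} (hz : ∀ v i, ‖z v i‖ ≤ 1)
    {c : Fin k → ℂ} {ρ : ℝ} (hc : ∀ i, ‖c i‖ ≤ ρ) (t : ℕ) (v : Stick R k) :
    ‖partialMean z c t v‖ ≤ ρ ^ min t v.2.length := by
  rw [partialMean, norm_mul, ← List.length_take]
  calc _ ≤ ‖((v.2.take t).map c).prod‖ * 1 :=
        mul_le_mul_of_nonneg_left (norm_pathProd_le_one hz _) (norm_nonneg _)
    _ ≤ _ := by
        rw [mul_one]
        exact norm_prod_map_le_pow hc _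

lemma partialMean_sub {z : Stick R k → Fin k → ℂ} {c : Fin k → ℂ} {t : ℕ} {v : Stick R k}
    {i : Fin k} {l : List (Fin k)} (h : v.2.drop t = i :: l) :
    partialMean z c t v - partialMean z c (t + 1) v =
      pathProd z (v.1, l) * (((v.2.take t).map c).prod * (z (v.1, l) i - c i)) := by
  have hd : v.2.drop (t + 1) = l := by
    rw [← List.drop_drop, h]
    rfl
  have ht : v.2.take (t + 1) = v.2.take t ++ [i] := by
    rw [List.take_add, h]
    rfl
  rw [partialMean, partialMean, h, hd, ht, pathProd, List.map_append, List.prod_append]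
  simp only [List.map_cons, List.map_nil, List.prod_singleton]
  ring

lemma partialMean_succ_of_length_le {z : Stick R k → Fin k → ℂ} {c : Fin k → ℂ} {t : ℕ}
    {v : Stick R k} (h : v.2.length ≤ t) : partialMean z c (t + 1) v = partialMean z c t v := by
  rw [partialMean, partialMean, List.drop_eq_nil_of_le h, List.drop_eq_nil_of_le (by omega),
    List.take_of_length_le h, List.take_of_length_le (by omega)]

/-- The `t`-th difference at `v` sees the weight at the ancestor `u` which is `t + 1` levels up, and
vanishes if there is none. Grouping by `u` separates `pathProd z u`, which involves only the weights
strictly above `u`, from a function of `z u` alone: this is the martingale structure. -/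
lemma sum_partialMean_sub (z : Stick R k → Fin k → ℂ) (c : Fin k → ℂ) (t : ℕ)
    (V : Finset (Stick R k)) :
    ∑ v ∈ V, (partialMean z c t v - partialMean z c (t + 1) v) =
      ∑ u ∈ V.image fun v => (v.1, v.2.drop (t + 1)), pathProd z u * increment V c t u (z u) := by
  simp only [increment, Finset.mul_sum]
  rw [Finset.sum_comm]
  refine Finset.sum_congr rfl fun v hv => ?_
  rcases h : v.2.drop t with _ | ⟨i, l⟩
  · rw [partialMean_succ_of_length_le (List.drop_eq_nil_iff.mp h), sub_self]
    refine (Finset.sum_eq_zero fun u _ => Finset.sum_eq_zero fun i _ => ?_).symm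
    simp
  · have hd : v.2.drop (t + 1) = l := by
      rw [← List.drop_drop, h]
      rfl
    rw [partialMean_sub h, Finset.sum_eq_single (v.1, l), Finset.sum_eq_single i]
    · simp
    · intro i' _ hi'
      simp [hi'.symm]
    · simp
    · rintro ⟨j, l'⟩ _ hu
      refine Finset.sum_eq_zero fun i' _ => ?_
      rw [if_neg, mul_zero]
      rintro h'
      simp only [Prod.mk.injEq, List.cons.injEq] at h'
      exact hu (by rw [h'.1, h'.2.2])
    · intro hn
      exact absurd (Finset.mem_image.mpr ⟨v, hv, by rw [hd]⟩) hn

/-- The sticks that contribute lie exactly `t + 1` levels below `u`, hence are determined by the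
word leading from `u` to them; each contributes at most `2`. -/
lemma norm_increment_le (V : Finset (Stick R k)) {c : Fin k → ℂ} (hc : ∀ i, ‖c i‖ ≤ 1) (t : ℕ)
    (u : Stick R k) {x : Fin k → ℂ} (hx : ∀ i, ‖x i‖ ≤ 1) :
    ‖increment V c t u x‖ ≤ 2 * (shortWords k (t + 2)).card := by
  set W := V.filter fun v => ∃ i, (v.1, v.2.drop t) = (u.1, i :: u.2) with hW
  have hcard : W.card ≤ (shortWords k (t + 2)).card := by
    refine Finset.card_le_card_of_injOn (fun v => v.2.take (t + 1)) (fun v _ => ?_) ?_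
    · rw [Finset.mem_coe, mem_shortWords, List.length_take]
      omega
    · intro v hv w hw hvw
      obtain ⟨i, hi⟩ := (Finset.mem_filter.mp hv).2
      obtain ⟨i', hi'⟩ := (Finset.mem_filter.mp hw).2
      simp only [Prod.mk.injEq] at hi hi'
      have h1 : v.2.drop (t + 1) = u.2 := by rw [← List.drop_drop, hi.2]; rfl
      have h2 : w.2.drop (t + 1) = u.2 := by rw [← List.drop_drop, hi'.2]; rfl
      refine Prod.ext (hi.1.trans hi'.1.symm) ?_
      rw [← List.take_append_drop (t + 1) v.2, ← List.take_append_drop (t + 1) w.2, h1, h2]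
      exact congrArg (· ++ u.2) hvw
  have hterm : ∀ v ∈ V, ‖∑ i, if (v.1, v.2.drop t) = (u.1, i :: u.2) then
      ((v.2.take t).map c).prod * (x i - c i) else 0‖ ≤
      if ∃ i, (v.1, v.2.drop t) = (u.1, i :: u.2) then 2 else 0 := by
    intro v _
    split_ifs with h
    · obtain ⟨i, hi⟩ := h
      rw [Finset.sum_eq_single i, if_pos hi, norm_mul]
      · have h1 := norm_prod_map_le_pow hc (v.2.take t)
        rw [one_pow] at h1
        have h2 : ‖x i - c i‖ ≤ 2 := (norm_sub_le _ _).trans (by linarith [hx i, hc i])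
        calc _ ≤ 1 * (2 : ℝ) := mul_le_mul h1 h2 (norm_nonneg _) zero_le_one
          _ = 2 := one_mul 2
      · intro i' _ hi'
        rw [if_neg]
        intro h
        rw [hi] at h
        simp only [Prod.mk.injEq, List.cons.injEq] at h
        exact hi' h.2.1.symm
      · simp
    · rw [Finset.sum_eq_zero, norm_zero]
      exact fun i _ => if_neg fun hi => h ⟨i, hi⟩
  calc ‖increment V c t u x‖ ≤ ∑ v ∈ V, _ := (norm_sum_le _ _).trans (Finset.sum_le_sum hterm)
    _ = 2 * (W.card : ℝ) := by
        rw [← Finset.sum_filter, Finset.sum_const, nsmul_eq_mul, mul_comm]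
    _ ≤ _ := by gcongr

lemma card_filter_length_lt_le (V : Finset (Stick R k)) (m : ℕ) :
    (V.filter fun v => v.2.length < m).card ≤ R * (shortWords k m).card := by
  have : V.filter (fun v => v.2.length < m) ⊆ Finset.univ ×ˢ shortWords k m := by
    intro v hv
    rw [Finset.mem_product]
    exact ⟨Finset.mem_univ _, mem_shortWords.mpr (Finset.mem_filter.mp hv).2⟩
  simpa using Finset.card_le_card this

/-- The deterministic part of the argument: shallow sticks are counted trivially, deep ones gain `ρ
^ m`, and the rest is telescoping error. -/
lemma norm_sum_pathProd_le {z : Stick R k → Fin k → ℂ} (hz : ∀ v i, ‖z v i‖ ≤ 1)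
    {c : Fin k → ℂ} {ρ : ℝ} (hρ : 0 ≤ ρ) (hρ1 : ρ ≤ 1) (hc : ∀ i, ‖c i‖ ≤ ρ) (m : ℕ)
    (V : Finset (Stick R k)) :
    ‖∑ v ∈ V, pathProd z v‖ ≤ R * (shortWords k m).card + ρ ^ m * V.card +
      ∑ t ∈ Finset.range m,
        ‖∑ v ∈ V, (partialMean z c t v - partialMean z c (t + 1) v)‖ := by
  have htel : ∑ v ∈ V, pathProd z v = ∑ v ∈ V, partialMean z c m v +
      ∑ t ∈ Finset.range m, ∑ v ∈ V, (partialMean z c t v - partialMean z c (t + 1) v) := by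
    rw [Finset.sum_comm, ← Finset.sum_add_distrib]
    refine Finset.sum_congr rfl fun v _ => ?_
    rw [Finset.sum_range_sub', partialMean_zero]
    ring
  have hmain : ‖∑ v ∈ V, partialMean z c m v‖ ≤ R * (shortWords k m).card + ρ ^ m * V.card := by
    calc _ ≤ ∑ v ∈ V, ((if v.2.length < m then 1 else 0) + ρ ^ m) := by
          refine (norm_sum_le _ _).trans (Finset.sum_le_sum fun v _ => ?_)
          refine (norm_partialMean_le hz hc m v).trans ?_
          split_ifs with h
          · exact (pow_le_one₀ hρ hρ1).trans (by linarith [pow_nonneg hρ m])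
          · rw [min_eq_left (not_lt.mp h), zero_add]
      _ = ((V.filter fun v => v.2.length < m).card : ℝ) + ρ ^ m * V.card := by
          rw [Finset.sum_add_distrib, Finset.sum_boole, Finset.sum_const, nsmul_eq_mul, mul_comm]
      _ ≤ _ := by
          gcongr
          exact_mod_cast card_filter_length_lt_le V m
  rw [htel]
  exact (norm_add_le _ _).trans (add_le_add hmain (norm_sum_le _ _))

end StickBreaking

namespace StickBreaking

/-! ### Independence of the driving data -/

lemma iIndepFun_bool_of_indepFun {Ω : Type*} [MeasurableSpace Ω] {μ : Measure Ω}
    [IsProbabilityMeasure μ] {β : Type*} [MeasurableSpace β]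
    {X : Bool → Ω → β} (h : IndepFun (X true) (X false) μ) : iIndepFun X μ := by
  rw [iIndepFun_iff_measure_inter_preimage_eq_mul]
  intro S sets hS
  have key := indepFun_iff_measure_inter_preimage_eq_mul.mp h
  by_cases ht : true ∈ S <;> by_cases hf : false ∈ S
  · have : S = {true, false} := by ext b; cases b <;> simp [ht, hf]
    subst this
    rw [Finset.set_biInter_insert, Finset.set_biInter_singleton, Finset.prod_pair (by simp)]
    exact key _ _ (hS true ht) (hS false hf)
  · have : S = {true} := by ext b; cases b <;> simp [ht, hf]
    subst this
    simp
  · have : S = {false} := by ext b; cases b <;> simp [ht, hf]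
    subst this
    simp
  · have : S = ∅ := by ext b; cases b <;> simp [ht, hf]
    subst this
    simp

variable {Ω : Type*} {R k : ℕ}

lemma measurable_pathProd {m : MeasurableSpace Ω} {z : Stick R k → Ω → Fin k → ℂ} (v : Stick R k)
    (hz : ∀ w : Stick R k, w.2.length < v.2.length → ∀ i, Measurable fun ω => z w ω i) :
    Measurable fun ω => pathProd (fun w => z w ω) v := by
  obtain ⟨j, l⟩ := v
  induction l with
  | nil =>
    simp only [pathProd]
    exact measurable_const
  | cons i l ih =>
    simp only [pathProd]
    exact (ih fun w hw => hz w (hw.trans (Nat.lt_succ_self _))).mul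
      (hz (j, l) (Nat.lt_succ_self _) i)

/-- The `σ`-algebra generated by all statuses and by the cuts of all sticks other than `u`. -/
abbrev sigmaExcept (cut : Stick R k → Ω → Fin (k - 1) → ℝ) (status : Stick R k → Ω → Fin k → Bool)
    (u : Stick R k) : MeasurableSpace Ω :=
  (⨆ v, MeasurableSpace.comap (status v) inferInstance) ⊔
    ⨆ v, ⨆ _ : v ≠ u, MeasurableSpace.comap (cut v) inferInstance

lemma measurable_cut_sigmaExcept {cut : Stick R k → Ω → Fin (k - 1) → ℝ}
    {status : Stick R k → Ω → Fin k → Bool} {u v : Stick R k} (h : v ≠ u) :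
    Measurable[sigmaExcept cut status u] (cut v) :=
  measurable_iff_comap_le.mpr <|
    (le_iSup₂ (f := fun v (_ : v ≠ u) => MeasurableSpace.comap (cut v) inferInstance) v h).trans
      le_sup_right

variable [mΩ : MeasurableSpace Ω] {μ : Measure Ω} {D : Measure (Fin (k - 1) → ℝ)} {r : ℝ}
  {cut : Stick R k → Ω → Fin (k - 1) → ℝ} {status : Stick R k → Ω → Fin k → Bool}

lemma IsFragmentation.sigmaExcept_le (h : IsFragmentation μ D r cut status) (u : Stick R k) :
    sigmaExcept cut status u ≤ mΩ :=
  sup_le (iSup_le fun v => (h.measurable_status v).comap_le)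
    (iSup₂_le fun v _ => (h.measurable_cut v).comap_le)

/-- Independence across sticks and, within a stick, of cut and status makes all cuts and statuses a
single independent family, indexed by stick and `Bool`; then one member is split off from the
others. -/
lemma IsFragmentation.indep_sigmaExcept [IsProbabilityMeasure μ]
    (h : IsFragmentation μ D r cut status) (u : Stick R k) :
    Indep (sigmaExcept cut status u) (MeasurableSpace.comap (cut u) inferInstance) μ := by
  -- The sum type gives cuts and statuses a common codomain; they are recovered below by `Sum.elim`,
  -- with an irrelevant value on the other summand.
  let X : Stick R k → Bool → Ω → (Fin (k - 1) → ℝ) ⊕ (Fin k → Bool) :=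
    fun v b ω => cond b (Sum.inl (cut v ω)) (Sum.inr (status v ω))
  have hX : ∀ v b, Measurable (X v b) := by
    rintro v (_ | _)
    · exact measurable_inr.comp (h.measurable_status v)
    · exact measurable_inl.comp (h.measurable_cut v)
  have hpair : iIndepFun (fun v ω b => X v b ω) μ := by
    let g : (Fin (k - 1) → ℝ) × (Fin k → Bool) → Bool → (Fin (k - 1) → ℝ) ⊕ (Fin k → Bool) :=
      fun p b => cond b (Sum.inl p.1) (Sum.inr p.2)
    have hg : Measurable g := by
      refine measurable_pi_iff.mpr ?_
      rintro (_ | _)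
      · exact measurable_inr.comp measurable_snd
      · exact measurable_inl.comp measurable_fst
    exact h.indep_sticks.comp (fun _ => g) fun _ => hg
  have hall := iIndepFun_uncurry hX hpair fun v =>
    iIndepFun_bool_of_indepFun (X := X v)
      ((h.indep_cut_status v).comp measurable_inl measurable_inr)
  rw [iIndepFun_iff_iIndep] at hall
  have hcut : ∀ v, MeasurableSpace.comap (cut v) inferInstance ≤
      MeasurableSpace.comap (X v true) inferInstance := fun v =>
    measurable_iff_comap_le.mp <| show Measurable[MeasurableSpace.comap (X v true) inferInstance]
      ((Sum.elim id fun _ => 0) ∘ X v true) from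
      (measurable_id.sumElim measurable_const).comp (comap_measurable _)
  have hstatus : ∀ v, MeasurableSpace.comap (status v) inferInstance ≤
      MeasurableSpace.comap (X v false) inferInstance := fun v =>
    measurable_iff_comap_le.mp <| show Measurable[MeasurableSpace.comap (X v false) inferInstance]
      ((Sum.elim (fun _ _ => false) id) ∘ X v false) from
      (measurable_const.sumElim measurable_id).comp (comap_measurable _)
  have hdisj : Disjoint {p : (_ : Stick R k) × Bool | p ≠ ⟨u, true⟩} {⟨u, true⟩} :=
    Set.disjoint_singleton_right.mpr fun h => h rfl
  have hind := indep_iSup_of_disjoint (fun p => (hX p.1 p.2).comap_le) hall hdisj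
  refine indep_of_indep_of_le_left (indep_of_indep_of_le_right hind ?_) ?_
  · refine (hcut u).trans ?_
    exact le_iSup₂ (f := fun (p : (_ : Stick R k) × Bool) (_ : p ∈ ({⟨u, true⟩} : Set _)) =>
      MeasurableSpace.comap (X p.1 p.2) inferInstance) ⟨u, true⟩ rfl
  · refine sup_le (iSup_le fun v => ?_) (iSup₂_le fun v hv => ?_)
    · refine (hstatus v).trans ?_
      exact le_iSup₂ (f := fun (p : (_ : Stick R k) × Bool)
        (_ : p ∈ {p : (_ : Stick R k) × Bool | p ≠ ⟨u, true⟩}) =>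
        MeasurableSpace.comap (X p.1 p.2) inferInstance) ⟨v, false⟩ (by simp)
    · refine (hcut v).trans ?_
      exact le_iSup₂ (f := fun (p : (_ : Stick R k) × Bool)
        (_ : p ∈ {p : (_ : Stick R k) × Bool | p ≠ ⟨u, true⟩}) =>
        MeasurableSpace.comap (X p.1 p.2) inferInstance) ⟨v, true⟩ (by simpa using hv)

/-! ### Concentration of sums of characters over a given set of sticks -/

lemma measurable_increment {β : Type*} [MeasurableSpace β] (V : Finset (Stick R k))
    (c : Fin k → ℂ) (t : ℕ) (u : Stick R k) {x : β → Fin k → ℂ} (hx : Measurable x) :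
    Measurable fun y => increment V c t u (x y) := by
  unfold increment
  refine Finset.measurable_fun_sum _ fun v _ => Finset.measurable_fun_sum _ fun i _ => ?_
  split_ifs
  · exact (((measurable_pi_apply i).comp hx).sub_const _).const_mul _
  · exact measurable_const

/-- The weights given by a logarithmic character of the gaps. -/
noncomputable def charWeight (k : ℕ) (B : ℝ) (n : ℤ) (x : Fin (k - 1) → ℝ) (i : Fin k) : ℂ :=
  logChar B n (gap x i)

lemma measurable_charWeight (B : ℝ) (n : ℤ) : Measurable (charWeight k B n) :=
  measurable_pi_iff.mpr fun _ => (measurable_logChar B n).comp (measurable_gap _)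

lemma norm_charWeight (B : ℝ) (n : ℤ) (x : Fin (k - 1) → ℝ) (i : Fin k) :
    ‖charWeight k B n x i‖ = 1 := norm_logChar _ _ _

lemma IsFragmentation.integral_increment [IsProbabilityMeasure μ]
    (h : IsFragmentation μ D r cut status) (B : ℝ) (n : ℤ)
    (V : Finset (Stick R k)) (t : ℕ) (u w : Stick R k) :
    ∫ ω, increment V (fun i => gapMean D B n i) t u (charWeight k B n (cut w ω)) ∂μ = 0 := by
  have hm : ∀ i, Measurable fun ω => charWeight k B n (cut w ω) i := fun i =>
    (measurable_pi_iff.mp (measurable_charWeight B n) i).comp (h.measurable_cut w)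
  have hint : ∀ i, Integrable (fun ω => charWeight k B n (cut w ω) i) μ := fun i =>
    Integrable.of_bound (hm i).aestronglyMeasurable 1 (ae_of_all _ fun ω =>
      (norm_charWeight _ _ _ _).le)
  have hmean : ∀ i : Fin k, ∫ ω, charWeight k B n (cut w ω) i ∂μ = gapMean D B n i := by
    intro i
    rw [gapMean, ← h.law_cut w, integral_map (h.measurable_cut w).aemeasurable]
    · rfl
    · exact ((measurable_logChar B n).comp (measurable_gap _)).aestronglyMeasurable
  have hterm : ∀ (v : Stick R k) (i : Fin k), Integrable (fun ω =>
      if (v.1, v.2.drop t) = (u.1, i :: u.2) then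
      ((v.2.take t).map fun i : Fin k => gapMean D B n i).prod *
        (charWeight k B n (cut w ω) i - gapMean D B n i) else 0) μ := by
    intro v i
    split_ifs
    · exact ((hint i).sub (integrable_const _)).const_mul _
    · exact integrable_zero _ _ _
  unfold increment
  rw [integral_finsetSum _ fun v _ => integrable_finsetSum _ fun i _ => hterm v i]
  refine Finset.sum_eq_zero fun v _ => ?_
  rw [integral_finsetSum _ fun i _ => hterm v i]
  refine Finset.sum_eq_zero fun i _ => ?_
  split_ifs
  · rw [integral_const_mul, integral_sub (hint i) (integrable_const _), hmean]
    simp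
  · simp

/-- The `t`-th telescoping term in the decomposition of the sum over `V` of the characters. -/
noncomputable def telescopeTerm (D : Measure (Fin (k - 1) → ℝ)) (B : ℝ) (n : ℤ) (t : ℕ)
    (V : Finset (Stick R k)) (x : Stick R k → Fin (k - 1) → ℝ) : ℂ :=
  ∑ v ∈ V, (partialMean (fun w => charWeight k B n (x w)) (fun i => gapMean D B n i) t v -
    partialMean (fun w => charWeight k B n (x w)) (fun i => gapMean D B n i) (t + 1) v)

lemma IsFragmentation.measurable_telescopeTerm (h : IsFragmentation μ D r cut status) (B : ℝ)
    (n : ℤ) (t : ℕ) (V : Finset (Stick R k)) :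
    Measurable fun ω => telescopeTerm D B n t V fun w => cut w ω := by
  have hz : ∀ (w : Stick R k) i, Measurable fun ω => charWeight k B n (cut w ω) i := fun w i =>
    (measurable_pi_iff.mp (measurable_charWeight B n) i).comp (h.measurable_cut w)
  have hp : ∀ t v, Measurable fun ω =>
      partialMean (fun w => charWeight k B n (cut w ω)) (fun i => gapMean D B n i) t v :=
    fun t v => (measurable_pathProd (z := fun w ω => charWeight k B n (cut w ω)) _
      fun w _ i => hz w i).const_mul _
  exact Finset.measurable_fun_sum _ fun v _ => (hp t v).sub (hp (t + 1) v)

/-- Here `V` is fixed, and `A` is meant to be the event that `V` is the set of sticks present.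
Keeping the factor `μ A` on the right lets the bounds be summed over all `V` at no cost. -/
lemma IsFragmentation.measure_le_re_telescopeTerm [IsProbabilityMeasure μ]
    [IsProbabilityMeasure D] (h : IsFragmentation μ D r cut status) (B : ℝ) (n : ℤ) (t : ℕ)
    (V : Finset (Stick R k))
    {A : Set Ω} (hA : MeasurableSet[⨆ v, MeasurableSpace.comap (status v) inferInstance] A)
    {ζ : ℂ} (hζ : ‖ζ‖ = 1) {η : ℝ} (hη : 0 < η) :
    μ (A ∩ {ω | η * V.card ≤ (ζ * telescopeTerm D B n t V fun w => cut w ω).re}) ≤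
      ENNReal.ofReal (Real.exp (-(η ^ 2 / (8 * (shortWords k (t + 2)).card ^ 2) * V.card))) *
        μ A := by
  set C : ℝ := ((shortWords k (t + 2)).card : ℝ) with hC
  have hC0 : 0 < C := by
    have : (shortWords k (t + 2)).Nonempty := ⟨[], mem_shortWords.mpr (by simp)⟩
    rw [hC]
    exact_mod_cast this.card_pos
  -- The minimizer of the Chernoff exponent `(2 * l ^ 2 * C ^ 2 - l * η) * V.card`.
  set l : ℝ := η / (4 * C ^ 2) with hl
  have hl0 : 0 < l := by positivity
  set c : Fin k → ℂ := fun i => gapMean D B n i with hc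
  set U := V.image fun v => (v.1, v.2.drop (t + 1)) with hU
  set a : Stick R k → Ω → ℂ := fun u ω => pathProd (fun w => charWeight k B n (cut w ω)) u with ha
  set H : Stick R k → (Fin (k - 1) → ℝ) → ℂ :=
    fun u y => ((l : ℂ) * ζ) * increment V c t u (charWeight k B n y) with hH
  have hAm : ∀ u, MeasurableSet[sigmaExcept cut status u] A := fun u =>
    (le_sup_left : _ ≤ sigmaExcept cut status u) A hA
  have ham : ∀ u w : Stick R k, w.2.length ≤ u.2.length →
      Measurable[sigmaExcept cut status u] (a w) := by
    intro u w hw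
    refine measurable_pathProd (m := sigmaExcept cut status u)
      (z := fun w ω => charWeight k B n (cut w ω)) w fun v hv i => ?_
    exact (measurable_pi_iff.mp (measurable_charWeight B n) i).comp
      (measurable_cut_sigmaExcept fun hvu => by rw [hvu] at hv; omega)
  have hHm : ∀ u, Measurable (H u) := fun u =>
    (measurable_increment V c t u (measurable_charWeight B n)).const_mul _
  have hHb : ∀ u y, ‖H u y‖ ≤ l * (2 * C) := by
    intro u y
    simp only [hH]
    rw [norm_mul, norm_mul, hζ, mul_one, Complex.norm_real, Real.norm_eq_abs, abs_of_pos hl0]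
    exact mul_le_mul_of_nonneg_left (norm_increment_le V (fun i => norm_gapMean_le_one D B n i) t u
      fun i => (norm_charWeight _ _ _ _).le) hl0.le
  have hH0 : ∀ u, ∫ ω, H u (cut u ω) ∂μ = 0 := by
    intro u
    simp only [hH]
    rw [integral_const_mul, h.integral_increment, mul_zero]
  have hgm : ∀ u, Measurable[sigmaExcept cut status u] (A.indicator (1 : Ω → ℝ≥0∞)) := fun u =>
    Measurable.indicator (@measurable_one _ _ _ (sigmaExcept cut status u) _) (hAm u)
  have key := lintegral_exp_sum_le (μ := μ) h.measurable_cut (g := A.indicator 1)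
    (a := a) (fun u ω => norm_pathProd_le_one (fun v i => (norm_charWeight _ _ _ _).le) u)
    hHm (fun u ω => hHb u _) hH0 (fun u => u.2.length) (sigmaExcept cut status) h.sigmaExcept_le
    h.indep_sigmaExcept hgm
    (fun u => ham u u le_rfl) U
    (fun u w _ hwu hd => ⟨ham u w hd, measurable_cut_sigmaExcept hwu⟩)
  have hA' : MeasurableSet A :=
    (iSup_le fun v => (h.measurable_status v).comap_le :
      (⨆ v, MeasurableSpace.comap (status v) inferInstance) ≤ mΩ) A hA
  have hsum : ∀ ω, ∑ u ∈ U, a u ω * H u (cut u ω) =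
      (l : ℂ) * (ζ * telescopeTerm D B n t V fun w => cut w ω) := by
    intro ω
    rw [telescopeTerm, sum_partialMean_sub, Finset.mul_sum, Finset.mul_sum]
    refine Finset.sum_congr rfl fun u _ => ?_
    simp only [ha, hH]
    ring
  simp only [hsum, Complex.re_ofReal_mul] at key
  rw [lintegral_indicator_one hA'] at key
  have hX : Measurable fun ω => l * (ζ * telescopeTerm D B n t V fun w => cut w ω).re :=
    (Complex.measurable_re.comp ((h.measurable_telescopeTerm B n t V).const_mul ζ)).const_mul l
  have hfin := measure_inter_le_of_lintegral_exp_le hA' hX (t := l * (η * V.card)) key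
  have hset : {ω | l * (η * V.card) ≤ l * (ζ * telescopeTerm D B n t V fun w => cut w ω).re} =
      {ω | η * V.card ≤ (ζ * telescopeTerm D B n t V fun w => cut w ω).re} := by
    ext ω
    exact mul_le_mul_iff_right₀ hl0
  rw [hset] at hfin
  refine hfin.trans (mul_le_mul_left (ENNReal.ofReal_le_ofReal (Real.exp_le_exp.mpr ?_)) _)
  have hUV : (U.card : ℝ) ≤ V.card := by exact_mod_cast Finset.card_image_le
  have e1 : (l * (2 * C)) ^ 2 / 2 = η ^ 2 / (8 * C ^ 2) := by
    rw [hl]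
    field_simp
    norm_num
  have e2 : l * (η * V.card) = 2 * (η ^ 2 / (8 * C ^ 2) * V.card) := by
    rw [hl]
    field_simp
    ring
  rw [e1, e2]
  have := mul_le_mul_of_nonneg_right hUV (show 0 ≤ η ^ 2 / (8 * C ^ 2) by positivity)
  linarith

lemma IsFragmentation.measure_lt_norm_telescopeTerm [IsProbabilityMeasure μ]
    [IsProbabilityMeasure D] (h : IsFragmentation μ D r cut status) (B : ℝ) (n : ℤ) (t : ℕ)
    (V : Finset (Stick R k))
    {A : Set Ω} (hA : MeasurableSet[⨆ v, MeasurableSpace.comap (status v) inferInstance] A)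
    {η : ℝ} (hη : 0 < η) :
    μ (A ∩ {ω | 2 * η * V.card < ‖telescopeTerm D B n t V fun w => cut w ω‖}) ≤
      4 * ENNReal.ofReal (Real.exp (-(η ^ 2 / (8 * (shortWords k (t + 2)).card ^ 2) * V.card))) *
        μ A := by
  set T := fun ω => telescopeTerm D B n t V fun w => cut w ω with hT
  have hsub : A ∩ {ω | 2 * η * V.card < ‖T ω‖} ⊆
      ⋃ ζ ∈ ({1, -1, Complex.I, -Complex.I} : Finset ℂ),
        A ∩ {ω | η * V.card ≤ (ζ * T ω).re} := by
    rintro ω ⟨hωA, hω⟩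
    rw [Set.mem_ofPred_eq] at hω
    have hn := Complex.norm_le_abs_re_add_abs_im (T ω)
    simp only [Finset.mem_insert, Finset.mem_singleton, Set.mem_iUnion, exists_prop,
      exists_eq_or_imp, exists_eq_left, Set.mem_inter_iff, hωA, true_and, Set.mem_ofPred_eq,
      one_mul, neg_mul, Complex.neg_re, Complex.I_mul_re, neg_neg]
    -- If all four directions stay below `η * V.card`, so do `|re|` and `|im|`, and the norm is at
    -- most their sum.
    by_contra! hcon
    obtain ⟨h1, h2, h3, h4⟩ := hcon
    have := abs_lt.mpr ⟨neg_lt.mp h2, h1⟩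
    have := abs_lt.mpr ⟨neg_lt.mp h3, h4⟩
    linarith
  refine (measure_mono hsub).trans ((measure_biUnion_finset_le _ _).trans ?_)
  have hζ : ∀ ζ ∈ ({1, -1, Complex.I, -Complex.I} : Finset ℂ), ‖ζ‖ = 1 := by
    intro ζ hζ
    simp only [Finset.mem_insert, Finset.mem_singleton] at hζ
    rcases hζ with rfl | rfl | rfl | rfl <;> simp
  refine (Finset.sum_le_sum fun ζ hmem =>
    h.measure_le_re_telescopeTerm B n t V hA (hζ ζ hmem) hη).trans ?_
  rw [Finset.sum_const, nsmul_eq_mul, mul_assoc]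
  refine mul_le_mul_left ?_ _
  exact_mod_cast Finset.card_le_four

end StickBreaking

namespace StickBreaking

/-! ### The genealogical tree -/

variable {R k : ℕ}

lemma mem_sticksAfter_succ {status : Stick R k → Fin k → Bool} {N : ℕ} {v : Stick R k} :
    v ∈ sticksAfter status (N + 1) ↔ ∃ u ∈ sticksAfter status N,
      (IsAlive status u ∧ ∃ i, (u.1, i :: u.2) = v) ∨ (¬ IsAlive status u ∧ v = u) := by
  rw [sticksAfter, Finset.mem_biUnion]
  refine exists_congr fun u => and_congr_right fun _ => ?_
  split_ifs with h <;> simp [h]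

lemma length_of_mem_sticksAfter {status : Stick R k → Fin k → Bool} {N : ℕ} {v : Stick R k}
    (hv : v ∈ sticksAfter status N) :
    v.2.length ≤ N ∧ (IsAlive status v → v.2.length = N) := by
  induction N generalizing v with
  | zero =>
    simp only [sticksAfter, Finset.mem_image, Finset.mem_univ, true_and] at hv
    obtain ⟨j, rfl⟩ := hv
    simp
  | succ N ih =>
    obtain ⟨u, hu, ⟨ha, i, rfl⟩ | ⟨ha, rfl⟩⟩ := mem_sticksAfter_succ.mp hv
    · simp [(ih hu).2 ha]
    · exact ⟨(ih hu).1.trans (Nat.le_succ N), fun h => absurd h ha⟩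

open Classical in
-- The union is disjoint: living sticks all have depth `N`, so their children have depth `N + 1` and
-- cannot coincide with a dead stick, of depth at most `N`.
lemma card_sticksAfter_succ (status : Stick R k → Fin k → Bool) (N : ℕ) :
    (sticksAfter status (N + 1)).card =
      ∑ u ∈ sticksAfter status N, if IsAlive status u then k else 1 := by
  rw [sticksAfter, Finset.card_biUnion]
  · refine Finset.sum_congr rfl fun u _ => ?_
    split_ifs
    · rw [Finset.card_image_of_injective, Finset.card_univ, Fintype.card_fin]
      intro i i' h
      simpa using h
    · simp
  · intro u hu u' hu' huu'
    have hl := length_of_mem_sticksAfter hu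
    have hl' := length_of_mem_sticksAfter hu'
    rw [Function.onFun, Finset.disjoint_left]
    intro v hv hv'
    split_ifs at hv hv' with h1 h2 h2
    · simp only [Finset.mem_image, Finset.mem_univ, true_and] at hv hv'
      obtain ⟨i, rfl⟩ := hv
      obtain ⟨i', hi'⟩ := hv'
      simp only [Prod.mk.injEq, List.cons.injEq] at hi'
      exact huu' (Prod.ext hi'.1.symm hi'.2.2.symm)
    · simp only [Finset.mem_image, Finset.mem_univ, true_and, Finset.mem_singleton] at hv hv'
      obtain ⟨i, rfl⟩ := hv
      subst hv'
      have := hl'.1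
      simp only [List.length_cons] at this
      have := hl.2 h1
      omega
    · simp only [Finset.mem_image, Finset.mem_univ, true_and, Finset.mem_singleton] at hv hv'
      obtain ⟨i, rfl⟩ := hv'
      subst hv
      have := hl.1
      simp only [List.length_cons] at this
      have := hl'.2 h2
      omega
    · simp only [Finset.mem_singleton] at hv hv'
      exact huu' (hv.symm.trans hv')

open Classical in
lemma card_add_card_alive_le (hk : 2 ≤ k) (status : Stick R k → Fin k → Bool) (N : ℕ) :
    (sticksAfter status N).card + ((sticksAfter status N).filter (IsAlive status)).card ≤
      (sticksAfter status (N + 1)).card := by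
  rw [card_sticksAfter_succ, Finset.card_filter, Finset.card_eq_sum_ones,
    ← Finset.sum_add_distrib]
  refine Finset.sum_le_sum fun u _ => ?_
  split_ifs <;> omega

lemma le_card_sticksAfter (hk : 2 ≤ k) (status : Stick R k → Fin k → Bool) (N : ℕ) :
    R ≤ (sticksAfter status N).card := by
  induction N with
  | zero =>
    rw [sticksAfter, Finset.card_image_of_injective, Finset.card_univ, Fintype.card_fin]
    intro j j' h
    simpa using h
  | succ N ih =>
    have := card_add_card_alive_le hk status N
    omega

/-- The stick and all its ancestors are alive. -/
def AllAlive (status : Stick R k → Fin k → Bool) : Stick R k → Prop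
  | (_, []) => True
  | (j, i :: v) => AllAlive status (j, v) ∧ status (j, v) i = true

lemma allAlive_cons {status : Stick R k → Fin k → Bool} {j : Fin R} {i : Fin k}
    {l : List (Fin k)} :
    AllAlive status (j, i :: l) ↔ AllAlive status (j, l) ∧ status (j, l) i = true := by
  rw [AllAlive]

lemma AllAlive.isAlive {status : Stick R k → Fin k → Bool} {v : Stick R k}
    (h : AllAlive status v) : IsAlive status v := by
  obtain ⟨j, _ | ⟨i, l⟩⟩ := v
  · trivial
  · exact (allAlive_cons.mp h).2

/-- Statuses are given for every label, including descendants of dead sticks, and `IsAlive` reads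
only the last one; presence in the process requires the whole ancestry to be alive. -/
lemma AllAlive.mem_sticksAfter {status : Stick R k → Fin k → Bool} {v : Stick R k}
    (h : AllAlive status v) : v ∈ sticksAfter status v.2.length := by
  obtain ⟨j, l⟩ := v
  induction l with
  | nil => simp [sticksAfter]
  | cons i l ih =>
    have hl := (allAlive_cons.mp h).1
    exact mem_sticksAfter_succ.mpr ⟨(j, l), ih hl, Or.inl ⟨hl.isAlive, i, rfl⟩⟩

open Classical in
/-- The number of descendants of the `j`-th initial stick in generation `n` that are alive
together with all their ancestors. -/
noncomputable def aliveCount (status : Stick R k → Fin k → Bool) (n : ℕ) (j : Fin R) : ℕ :=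
  ((Finset.univ : Finset (Fin n → Fin k)).filter fun f => AllAlive status (j, List.ofFn f)).card

/-- Each living stick of generation `n < N` breaks, and so adds at least `k - 1 ≥ 1` to the count.
-/
lemma sum_aliveCount_le_card (hk : 2 ≤ k) (status : Stick R k → Fin k → Bool) (N : ℕ) :
    ∑ n ∈ Finset.range N, ∑ j, aliveCount status n j ≤ (sticksAfter status N).card := by
  classical
  induction N with
  | zero => simp
  | succ N ih =>
    rw [Finset.sum_range_succ]
    refine (add_le_add ih ?_).trans (card_add_card_alive_le hk status N)
    simp only [aliveCount]
    rw [← Finset.card_sigma]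
    refine Finset.card_le_card_of_injOn (fun p => (p.1, List.ofFn p.2)) ?_ ?_
    · intro p hp
      simp only [Finset.mem_coe, Finset.mem_sigma, Finset.mem_univ, true_and,
        Finset.mem_filter] at hp ⊢
      have := hp.mem_sticksAfter
      simp only [List.length_ofFn] at this
      exact ⟨this, hp.isAlive⟩
    · rintro ⟨j, f⟩ _ ⟨j', f'⟩ _ h
      simp only [Prod.mk.injEq] at h
      obtain ⟨rfl, h⟩ := h
      rw [List.ofFn_injective h]

/-! ### Measurability of the tree -/

variable {Ω : Type*}

lemma measurableSet_isAlive {m : MeasurableSpace Ω} {status : Stick R k → Ω → Fin k → Bool}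
    (h : ∀ v, Measurable (status v)) (v : Stick R k) :
    MeasurableSet {ω | IsAlive (fun v => status v ω) v} := by
  obtain ⟨j, _ | ⟨i, l⟩⟩ := v
  · simp [IsAlive]
  · exact ((measurable_pi_apply i).comp (h (j, l))) (measurableSet_singleton true)

/-- The hypothesis is confined to shorter sticks with the same root: the first restriction gives
independence between generations, the second between initial sticks. -/
lemma measurableSet_allAlive {m : MeasurableSpace Ω} {status : Stick R k → Ω → Fin k → Bool}
    (v : Stick R k)
    (h : ∀ w : Stick R k, w.1 = v.1 → w.2.length < v.2.length → Measurable (status w)) :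
    MeasurableSet {ω | AllAlive (fun v => status v ω) v} := by
  obtain ⟨j, l⟩ := v
  induction l with
  | nil => simp [AllAlive]
  | cons i l ih =>
    simp only [allAlive_cons]
    exact (ih fun w hj hw => h w hj (hw.trans (Nat.lt_succ_self _))).inter
      (((measurable_pi_apply i).comp (h (j, l) rfl (Nat.lt_succ_self _)))
        (measurableSet_singleton true))

lemma measurableSet_mem_sticksAfter {m : MeasurableSpace Ω}
    {status : Stick R k → Ω → Fin k → Bool} (h : ∀ v, Measurable (status v)) (N : ℕ)
    (v : Stick R k) : MeasurableSet {ω | v ∈ sticksAfter (fun v => status v ω) N} := by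
  induction N generalizing v with
  | zero => simp only [sticksAfter]; exact MeasurableSet.const _
  | succ N ih =>
    simp only [mem_sticksAfter_succ]
    refine MeasurableSet.congr (MeasurableSet.iUnion fun u => (ih u).inter
      (((measurableSet_isAlive h u).inter
        (MeasurableSet.const (∃ i, (u.1, i :: u.2) = v))).union
        ((measurableSet_isAlive h u).compl.inter (MeasurableSet.const (v = u))))) ?_
    ext ω
    simp only [Set.mem_iUnion]
    rfl

lemma measurableSet_sticksAfter_eq {m : MeasurableSpace Ω}
    {status : Stick R k → Ω → Fin k → Bool} (h : ∀ v, Measurable (status v)) (N : ℕ)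
    (V : Finset (Stick R k)) :
    MeasurableSet {ω | sticksAfter (fun v => status v ω) N = V} := by
  have : {ω | sticksAfter (fun v => status v ω) N = V} =
      ⋂ v, {ω | v ∈ sticksAfter (fun v => status v ω) N ↔ v ∈ V} := by
    ext ω
    simp [Finset.ext_iff]
  rw [this]
  exact MeasurableSet.iInter fun v =>
    (measurableSet_mem_sticksAfter h N v).iff (MeasurableSet.const _)

end StickBreaking

namespace StickBreaking

/-! ### The number of living sticks -/

variable {Ω : Type*} {R k : ℕ} {status : Stick R k → Ω → Fin k → Bool}

lemma measurable_of_mem_iSup_comap (status : Stick R k → Ω → Fin k → Bool) {S : Set (Stick R k)}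
    {v : Stick R k} (hv : v ∈ S) :
    Measurable[⨆ v ∈ S, MeasurableSpace.comap (status v) inferInstance] (status v) :=
  measurable_iff_comap_le.mpr
    (le_iSup₂ (f := fun v (_ : v ∈ S) => MeasurableSpace.comap (status v) inferInstance) v hv)

lemma aliveCount_eq_sum (status : Stick R k → Ω → Fin k → Bool) (n : ℕ) (j : Fin R) (ω : Ω) :
    (aliveCount (fun v => status v ω) n j : ℝ) =
      ∑ f : Fin n → Fin k,
        {ω | AllAlive (fun v => status v ω) (j, List.ofFn f)}.indicator (1 : Ω → ℝ) ω := by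
  classical
  rw [aliveCount, Finset.card_filter]
  push_cast
  refine Finset.sum_congr rfl fun f _ => ?_
  simp only [Set.indicator_apply, Set.mem_ofPred_eq, Pi.one_apply]

lemma aliveCount_le (status : Stick R k → Fin k → Bool) (n : ℕ) (j : Fin R) :
    aliveCount status n j ≤ k ^ n := by
  classical
  rw [aliveCount]
  refine (Finset.card_filter_le _ _).trans ?_
  simp

lemma measurable_aliveCount {m : MeasurableSpace Ω} (n : ℕ) (j : Fin R)
    (h : ∀ v : Stick R k, v.1 = j → Measurable (status v)) :
    Measurable fun ω => (aliveCount (fun v => status v ω) n j : ℝ) := by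
  simp only [aliveCount_eq_sum]
  refine Finset.measurable_fun_sum _ fun f _ => Measurable.indicator measurable_one ?_
  exact measurableSet_allAlive _ fun w hw _ => h w hw

variable [mΩ : MeasurableSpace Ω] {μ : Measure Ω} {D : Measure (Fin (k - 1) → ℝ)} {r : ℝ}
  {cut : Stick R k → Ω → Fin (k - 1) → ℝ}

lemma IsFragmentation.indep_status (h : IsFragmentation μ D r cut status) {S T : Set (Stick R k)}
    (hST : Disjoint S T) :
    Indep (⨆ v ∈ S, MeasurableSpace.comap (status v) inferInstance)
      (⨆ v ∈ T, MeasurableSpace.comap (status v) inferInstance) μ := by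
  have hind : iIndepFun status μ := h.indep_sticks.comp (fun _ => Prod.snd) fun _ => measurable_snd
  rw [iIndepFun_iff_iIndep] at hind
  exact indep_iSup_of_disjoint (fun v => (h.measurable_status v).comap_le) hind hST

/-- A branch uses one status per parent, and distinct parents are independent, so the dependence
between siblings plays no role. -/
lemma IsFragmentation.measure_allAlive [IsProbabilityMeasure μ]
    (h : IsFragmentation μ D r cut status) (j : Fin R) (l : List (Fin k)) :
    μ {ω | AllAlive (fun v => status v ω) (j, l)} = ENNReal.ofReal r ^ l.length := by
  induction l with
  | nil => simp [AllAlive]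
  | cons i l ih =>
    have hdisj : Disjoint {w : Stick R k | w.2.length < l.length} {(j, l)} :=
      Set.disjoint_singleton_right.mpr (lt_irrefl l.length)
    have hmul := (Indep_iff _ _ μ).mp (h.indep_status hdisj)
      {ω | AllAlive (fun v => status v ω) (j, l)} {ω | status (j, l) ω i = true}
      (measurableSet_allAlive _ fun w _ hw => measurable_of_mem_iSup_comap status hw)
      (((measurable_pi_apply i).comp
        (measurable_of_mem_iSup_comap status (Set.mem_singleton (j, l))))
          (measurableSet_singleton true))
    simp only [allAlive_cons]
    rw [List.length_cons, pow_succ, ← ih, ← h.prob_alive (j, l) i, ← hmul]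
    rfl

/-- Criticality: there are `k ^ n` branches, each alive with probability `k ^ (-n)`. -/
lemma IsFragmentation.integral_aliveCount [IsProbabilityMeasure μ] (hk : 1 ≤ k)
    (h : IsFragmentation μ D (1 / (k : ℝ)) cut status) (n : ℕ) (j : Fin R) :
    ∫ ω, (aliveCount (fun v => status v ω) n j : ℝ) ∂μ = 1 := by
  have hm : ∀ f : Fin n → Fin k,
      MeasurableSet {ω | AllAlive (fun v => status v ω) (j, List.ofFn f)} := fun f =>
    measurableSet_allAlive _ fun w _ _ => h.measurable_status w
  have hk0 : (0 : ℝ) < k := by exact_mod_cast hk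
  simp only [aliveCount_eq_sum]
  rw [integral_finsetSum _ fun f _ => (integrable_const 1).indicator (hm f)]
  have : ∀ f : Fin n → Fin k,
      ∫ ω, {ω | AllAlive (fun v => status v ω) (j, List.ofFn f)}.indicator (1 : Ω → ℝ) ω ∂μ =
      (1 / (k : ℝ)) ^ n := by
    intro f
    rw [integral_indicator_one (hm f), Measure.real, h.measure_allAlive, ENNReal.toReal_pow,
      ENNReal.toReal_ofReal (by positivity), List.length_ofFn]
  simp only [this, Finset.sum_const, Finset.card_univ, Fintype.card_fun, Fintype.card_fin,
    nsmul_eq_mul, Nat.cast_pow, ← mul_pow]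
  rw [mul_one_div_cancel hk0.ne', one_pow]

/-- With overwhelming probability the tree has at least half the expected number of internal
vertices in the first `M` generations. -/
lemma exists_measure_sum_aliveCount_le (hk : 1 ≤ k) {M : ℕ} (hM : 1 ≤ M) : ∃ κ : ℝ, 0 < κ ∧
    ∀ {Ω : Type*} [MeasurableSpace Ω] (μ : Measure Ω) [IsProbabilityMeasure μ] {R : ℕ}
      {D : Measure (Fin (k - 1) → ℝ)} {cut : Stick R k → Ω → Fin (k - 1) → ℝ}
      {status : Stick R k → Ω → Fin k → Bool}, IsFragmentation μ D (1 / (k : ℝ)) cut status →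
      μ {ω | ∑ j, ∑ n ∈ Finset.range M, (aliveCount (fun v => status v ω) n j : ℝ) ≤ R * M / 2} ≤
        ENNReal.ofReal (Real.exp (-(κ * R))) := by
  set C : ℝ := ∑ n ∈ Finset.range M, (k : ℝ) ^ n with hC
  have hC0 : 0 ≤ C := Finset.sum_nonneg fun n _ => by positivity
  have hM0 : (0 : ℝ) < M := by exact_mod_cast hM
  refine ⟨M ^ 2 / (8 * (M + C) ^ 2), by positivity, ?_⟩
  intro Ω mΩ μ _ R D cut status h
  -- The minimizer of `R * (l ^ 2 * (M + C) ^ 2 / 2 - l * M / 2)`, where `M + C` bounds the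
  -- deviation of each `Y j` from its mean `M`.
  set l : ℝ := M / (2 * (M + C) ^ 2) with hl
  have hl0 : 0 < l := by positivity
  set Y : Fin R → Ω → ℝ := fun j ω =>
    ∑ n ∈ Finset.range M, (aliveCount (fun v => status v ω) n j : ℝ) with hY
  have hYm : ∀ {m : MeasurableSpace Ω} (j : Fin R),
      (∀ v : Stick R k, v.1 = j → Measurable (status v)) → Measurable (Y j) := fun j hj =>
    Finset.measurable_fun_sum _ fun n _ => measurable_aliveCount n j hj
  have hY0 : ∀ j ω, 0 ≤ Y j ω := fun j ω => Finset.sum_nonneg fun n _ => Nat.cast_nonneg _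
  have hYC : ∀ j ω, Y j ω ≤ C := fun j ω => Finset.sum_le_sum fun n _ => by
    exact_mod_cast aliveCount_le _ n j
  have hYmeas : ∀ j, Measurable (Y j) := fun j => hYm j fun v _ => h.measurable_status v
  have hYint : ∀ j, ∫ ω, Y j ω ∂μ = M := by
    intro j
    simp only [hY]
    rw [integral_finsetSum]
    · simp [h.integral_aliveCount hk]
    · intro n _
      refine Integrable.of_bound
        (measurable_aliveCount n j fun v _ => h.measurable_status v).aestronglyMeasurable
        ((k : ℝ) ^ n) (ae_of_all _ fun ω => ?_)
      rw [Real.norm_eq_abs, abs_of_nonneg (Nat.cast_nonneg _)]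
      exact_mod_cast aliveCount_le _ n j
  set H : Fin R → ℝ → ℂ := fun _ y => ((l * (M - y) : ℝ) : ℂ) with hH
  have hHm : ∀ j, Measurable (H j) := fun j =>
    Complex.measurable_ofReal.comp ((measurable_id.const_sub _).const_mul _)
  have hHb : ∀ j ω, ‖H j (Y j ω)‖ ≤ l * (M + C) := by
    intro j ω
    simp only [hH]
    rw [Complex.norm_real, Real.norm_eq_abs, abs_mul, abs_of_pos hl0]
    refine mul_le_mul_of_nonneg_left ?_ hl0.le
    rw [abs_le]
    constructor <;> linarith [hY0 j ω, hYC j ω]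
  have hH0 : ∀ j, ∫ ω, H j (Y j ω) ∂μ = 0 := by
    intro j
    simp only [hH]
    have hi : Integrable (Y j) μ := Integrable.of_bound (hYmeas j).aestronglyMeasurable C
      (ae_of_all _ fun ω => by
        rw [Real.norm_eq_abs, abs_of_nonneg (hY0 j ω)]
        exact hYC j ω)
    rw [integral_complex_ofReal, integral_const_mul, integral_sub (integrable_const _) hi, hYint]
    simp
  let m : Fin R → MeasurableSpace Ω := fun j =>
    ⨆ v ∈ {v : Stick R k | v.1 ≠ j}, MeasurableSpace.comap (status v) inferInstance
  have hind : ∀ j, Indep (m j) (MeasurableSpace.comap (Y j) inferInstance) μ := by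
    intro j
    have hdisj : Disjoint {v : Stick R k | v.1 ≠ j} {v : Stick R k | v.1 = j} :=
      Set.disjoint_left.mpr fun v hv hv' => hv hv'
    refine indep_of_indep_of_le_right (h.indep_status hdisj) (measurable_iff_comap_le.mp ?_)
    exact hYm j fun v hv => measurable_of_mem_iSup_comap status (S := {v | v.1 = j}) hv
  -- The trees of distinct initial sticks are independent, so a constant order `d` will do.
  have key := lintegral_exp_sum_le (μ := μ) hYmeas (g := Set.univ.indicator 1)
    (a := fun _ _ => 1) (fun _ _ => by simp) hHm hHb hH0 (fun _ => 0) m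
    (fun j => iSup₂_le fun v _ => (h.measurable_status v).comap_le) hind
    (fun j => Measurable.indicator (@measurable_one _ _ _ (m j) _) (@MeasurableSet.univ _ (m j)))
    (fun j => @measurable_const _ _ _ (m j) _) Finset.univ
    (fun j i _ hij _ => ⟨@measurable_const _ _ _ (m j) _, hYm i fun v hv =>
      measurable_of_mem_iSup_comap status (S := {v | v.1 ≠ j}) fun hvj =>
        hij (hv.symm.trans hvj)⟩)
  rw [lintegral_indicator_one MeasurableSet.univ] at key
  have hsum : ∀ ω, (∑ j, 1 * H j (Y j ω)).re = l * (R * M - ∑ j, Y j ω) := by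
    intro ω
    simp only [hH, one_mul]
    rw [← Complex.ofReal_sum, Complex.ofReal_re, ← Finset.mul_sum, Finset.sum_sub_distrib]
    simp
  simp only [hsum] at key
  have hX : Measurable fun ω => l * (R * M - ∑ j, Y j ω) :=
    ((Finset.measurable_fun_sum _ fun j _ => hYmeas j).const_sub _).const_mul _
  have hfin := measure_inter_le_of_lintegral_exp_le MeasurableSet.univ hX
    (t := l * (R * M / 2)) key
  rw [measure_univ, mul_one, Set.univ_inter, Finset.card_univ, Fintype.card_fin] at hfin
  refine (measure_mono fun ω hω => ?_).trans
    (hfin.trans (ENNReal.ofReal_le_ofReal (Real.exp_le_exp.mpr ?_)))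
  · rw [Set.mem_ofPred_eq] at hω ⊢
    exact mul_le_mul_of_nonneg_left (by linarith) hl0.le
  · refine le_of_eq ?_
    have : (M : ℝ) + C ≠ 0 := by positivity
    rw [hl]
    field_simp
    ring

end StickBreaking

namespace StickBreaking

/-! ### Almost sure convergence -/

variable {Ω : Type*} [mΩ : MeasurableSpace Ω] {μ : Measure Ω} {k : ℕ}
  {D : Measure (Fin (k - 1) → ℝ)}

/-- Partition according to the value `V` of the random set: the bounds carry the factors `μ {F =
V}`, whose sum is at most `1`. -/
lemma IsFragmentation.measure_lt_norm_telescopeTerm_sticksAfter [IsProbabilityMeasure μ]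
    [IsProbabilityMeasure D] {R : ℕ} {r : ℝ} {cut : Stick R k → Ω → Fin (k - 1) → ℝ}
    {status : Stick R k → Ω → Fin k → Bool} (h : IsFragmentation μ D r cut status) (hk : 2 ≤ k)
    (B : ℝ) (n : ℤ) (t N : ℕ) {η : ℝ} (hη : 0 < η) :
    μ {ω | 2 * η * (sticksAfter (fun v => status v ω) N).card <
        ‖telescopeTerm D B n t (sticksAfter (fun v => status v ω) N) fun w => cut w ω‖} ≤
      ENNReal.ofReal
        (4 * Real.exp (-(η ^ 2 / (8 * (shortWords k (t + 2)).card ^ 2) * R))) := by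
  set κ : ℝ := η ^ 2 / (8 * (shortWords k (t + 2)).card ^ 2) with hκ
  have hκ0 : 0 ≤ κ := by positivity
  set F : Ω → Finset (Stick R k) := fun ω => sticksAfter (fun v => status v ω) N with hF
  have hFm : ∀ V, MeasurableSet[⨆ v, MeasurableSpace.comap (status v) inferInstance]
      {ω | F ω = V} := fun V => measurableSet_sticksAfter_eq (fun v => measurable_iff_comap_le.mpr
        (le_iSup (fun v => MeasurableSpace.comap (status v) inferInstance) v)) N V
  have hFm' : ∀ V, MeasurableSet {ω | F ω = V} := fun V =>
    measurableSet_sticksAfter_eq h.measurable_status N V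
  have hbound : ∀ V, μ ({ω | F ω = V} ∩
      {ω | 2 * η * V.card < ‖telescopeTerm D B n t V fun w => cut w ω‖}) ≤
      ENNReal.ofReal (4 * Real.exp (-(κ * R))) * μ {ω | F ω = V} := by
    intro V
    rcases Set.eq_empty_or_nonempty {ω | F ω = V} with he | ⟨ω, rfl⟩
    · rw [he]
      simp
    refine (h.measure_lt_norm_telescopeTerm B n t _ (hFm (F ω)) hη).trans ?_
    refine mul_le_mul_left ?_ _
    rw [ENNReal.ofReal_mul (by norm_num), ENNReal.ofReal_ofNat]
    refine mul_le_mul_right (ENNReal.ofReal_le_ofReal (Real.exp_le_exp.mpr (neg_le_neg ?_))) _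
    refine mul_le_mul_of_nonneg_left ?_ hκ0
    exact_mod_cast le_card_sticksAfter hk _ N
  have hdisj : Pairwise fun V V' => Disjoint {ω | F ω = V} {ω | F ω = V'} := fun V V' hVV' =>
    Set.disjoint_left.mpr fun ω hω hω' => hVV' (hω.symm.trans hω')
  calc _ ≤ μ (⋃ V, {ω | F ω = V} ∩
        {ω | 2 * η * V.card < ‖telescopeTerm D B n t V fun w => cut w ω‖}) :=
        measure_mono fun ω hω => Set.mem_iUnion.mpr ⟨F ω, rfl, hω⟩
    _ ≤ ∑' V, μ ({ω | F ω = V} ∩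
        {ω | 2 * η * V.card < ‖telescopeTerm D B n t V fun w => cut w ω‖}) :=
        measure_iUnion_le _
    _ ≤ ∑' V, ENNReal.ofReal (4 * Real.exp (-(κ * R))) * μ {ω | F ω = V} :=
        ENNReal.tsum_le_tsum hbound
    _ = ENNReal.ofReal (4 * Real.exp (-(κ * R))) * μ (⋃ V, {ω | F ω = V}) := by
        rw [ENNReal.tsum_mul_left, measure_iUnion hdisj hFm']
    _ ≤ _ := mul_le_of_le_one_right zero_le prob_le_one

lemma summable_exp_neg_mul {κ : ℝ} (hκ : 0 < κ) :
    Summable fun R : ℕ => Real.exp (-(κ * R)) := by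
  have := Real.summable_exp_nat_mul_iff.mpr (neg_lt_zero.mpr hκ)
  refine this.congr fun R => ?_
  ring_nf

variable {cut : ∀ R : ℕ, Stick R k → Ω → Fin (k - 1) → ℝ}
  {status : ∀ R : ℕ, Stick R k → Ω → Fin k → Bool} {N : ℕ → ℕ}

lemma ae_eventually_norm_sum_pathProd_le [IsProbabilityMeasure μ] [IsProbabilityMeasure D]
    (hk : 2 ≤ k) (hD : IsGood D)
    (hproc : ∀ R : ℕ, IsFragmentation μ D (1 / (k : ℝ)) (cut R) (status R))
    (hN : Tendsto N atTop atTop) {B : ℝ} (hB : 1 < B) {n : ℤ} (hn : n ≠ 0) {ε : ℝ} (hε : 0 < ε) :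
    ∀ᵐ ω ∂μ, ∀ᶠ R in atTop,
      ‖∑ v ∈ sticksAfter (fun v => status R v ω) (N R),
        pathProd (fun w => charWeight k B n (cut R w ω)) v‖ ≤
      ε * (sticksAfter (fun v => status R v ω) (N R)).card := by
  obtain ⟨ρ, hρ0, hρ1, hρ⟩ := exists_norm_gapMean_le (by omega) hD hB hn
  -- Three errors of at most `ε / 4` times the number of sticks: `m` controls the deep sticks, `M`
  -- the shallow ones through `R * M / 2 < (F R ω).card`, and `η` the sum of the `m` telescoping
  -- terms.
  obtain ⟨m, hm⟩ := exists_pow_lt_of_lt_one (show 0 < ε / 4 by positivity) hρ1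
  obtain ⟨M, hM⟩ := exists_nat_gt (2 * (shortWords k m).card / (ε / 4) : ℝ)
  have hM0 : (0 : ℝ) < M := lt_of_le_of_lt (by positivity) hM
  obtain ⟨κ, hκ0, hκ⟩ := exists_measure_sum_aliveCount_le (k := k) (by omega)
    (M := M) (by exact_mod_cast hM0)
  set η : ℝ := ε / (8 * (m + 1)) with hη
  have hη0 : 0 < η := by positivity
  set F : ∀ R, Ω → Finset (Stick R k) :=
    fun R ω => sticksAfter (fun v => status R v ω) (N R) with hF
  have hcount : ∀ᵐ ω ∂μ, ∀ᶠ R in atTop, ω ∉ {ω | ∑ j, ∑ n ∈ Finset.range M,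
      (aliveCount (fun v => status R v ω) n j : ℝ) ≤ R * M / 2} := by
    refine ae_eventually_notMem (ne_top_of_le_ne_top ?_
      (ENNReal.tsum_le_tsum fun R => hκ μ (hproc R)))
    exact (summable_exp_neg_mul hκ0).tsum_ofReal_ne_top
  have htele : ∀ t : ℕ, ∀ᵐ ω ∂μ, ∀ᶠ R in atTop, ω ∉ {ω | 2 * η * (F R ω).card <
      ‖telescopeTerm D B n t (F R ω) fun w => cut R w ω‖} := by
    intro t
    have hC : (shortWords k (t + 2)).Nonempty := ⟨[], mem_shortWords.mpr (by simp)⟩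
    have hC0 : (0 : ℝ) < (shortWords k (t + 2)).card := by exact_mod_cast hC.card_pos
    refine ae_eventually_notMem (ne_top_of_le_ne_top ?_ (ENNReal.tsum_le_tsum fun R =>
      (hproc R).measure_lt_norm_telescopeTerm_sticksAfter hk B n t (N R) hη0))
    exact ((summable_exp_neg_mul (by positivity)).mul_left 4).tsum_ofReal_ne_top
  filter_upwards [hcount, ae_all_iff.mpr htele] with ω h1 h2
  have h2' : ∀ᶠ R in atTop, ∀ t ∈ Finset.range m, ω ∉ {ω | 2 * η * (F R ω).card <
      ‖telescopeTerm D B n t (F R ω) fun w => cut R w ω‖} :=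
    (Filter.eventually_all_finset _).mpr fun t _ => h2 t
  filter_upwards [h1, h2', hN.eventually_ge_atTop M] with R h1 h2 hNR
  rw [not_le] at h1
  have hcard : (R : ℝ) * M / 2 < (F R ω).card := by
    refine h1.trans_le ?_
    rw [Finset.sum_comm]
    refine le_trans (Finset.sum_le_sum_of_subset_of_nonneg (Finset.range_mono hNR)
      fun _ _ _ => by positivity) ?_
    exact_mod_cast sum_aliveCount_le_card hk (fun v => status R v ω) (N R)
  have hmain := norm_sum_pathProd_le (z := fun w => charWeight k B n (cut R w ω))
    (fun v i => (norm_charWeight _ _ _ _).le) hρ0 hρ1.le hρ m (F R ω)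
  refine hmain.trans ?_
  have ht : ∑ t ∈ Finset.range m, ‖telescopeTerm D B n t (F R ω) fun w => cut R w ω‖ ≤
      m * (2 * η * (F R ω).card) := by
    have := Finset.sum_le_card_nsmul (Finset.range m) _ _ fun t htm => by
      simpa using h2 t htm
    simpa using this
  have hcard0 : (0 : ℝ) ≤ (F R ω).card := Nat.cast_nonneg _
  have e1 : (R : ℝ) * (shortWords k m).card ≤ ε / 4 * (F R ω).card := by
    rw [div_lt_iff₀ (by positivity)] at hM
    have h3 : (R : ℝ) * (2 * (shortWords k m).card) ≤ R * (M * (ε / 4)) :=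
      mul_le_mul_of_nonneg_left hM.le (Nat.cast_nonneg _)
    have h4 : ε / 4 * (R * M / 2) ≤ ε / 4 * (F R ω).card :=
      mul_le_mul_of_nonneg_left hcard.le (by positivity)
    linarith
  have e2 : ρ ^ m * (F R ω).card ≤ ε / 4 * (F R ω).card :=
    mul_le_mul_of_nonneg_right hm.le hcard0
  have e3 : m * (2 * η * (F R ω).card) ≤ ε / 4 * (F R ω).card := by
    rw [← mul_assoc]
    refine mul_le_mul_of_nonneg_right ?_ hcard0
    rw [hη]
    have : (m : ℝ) * (2 * (ε / (8 * (m + 1)))) = ε / 4 * (m / (m + 1)) := by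
      field_simp
      ring
    rw [this]
    refine mul_le_of_le_one_right (by positivity) ?_
    rw [div_le_one (by positivity)]
    linarith
  have e4 := mul_nonneg hε.le hcard0
  change _ + _ + ∑ t ∈ Finset.range m, ‖telescopeTerm D B n t (F R ω) fun w => cut R w ω‖ ≤ _
  linarith

lemma stickLength_pos {R : ℕ} {L : ℝ} (hL : 0 < L) {x : Stick R k → Fin (k - 1) → ℝ}
    (hx : ∀ v, ∀ i : Fin k, 0 < gap (x v) i) (v : Stick R k) : 0 < stickLength L x v := by
  obtain ⟨j, l⟩ := v
  induction l with
  | nil => rwa [stickLength]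
  | cons i l ih =>
    rw [stickLength]
    exact mul_pos ih (hx _ _)

lemma logChar_stickLength {R : ℕ} {L : ℝ} (hL : 0 < L) {x : Stick R k → Fin (k - 1) → ℝ}
    (hx : ∀ v, ∀ i : Fin k, 0 < gap (x v) i) (B : ℝ) (n : ℤ) (v : Stick R k) :
    logChar B n (stickLength L x v) =
      logChar B n L * pathProd (fun w => charWeight k B n (x w)) v := by
  obtain ⟨j, l⟩ := v
  induction l with
  | nil => rw [stickLength, pathProd, mul_one]
  | cons i l ih =>
    rw [stickLength, pathProd, logChar_mul B n (stickLength_pos hL hx _).ne' (hx _ _).ne', ih,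
      mul_assoc]
    rfl

lemma ae_convergesToBenford [IsProbabilityMeasure μ] [IsProbabilityMeasure D]
    (hk : 2 ≤ k) (hD : IsGood D)
    (hproc : ∀ R : ℕ, IsFragmentation μ D (1 / (k : ℝ)) (cut R) (status R))
    (hN : Tendsto N atTop atTop) {B : ℝ} (hB : 1 < B) {L : ℝ} (hL : 0 < L) :
    ∀ᵐ ω ∂μ, ConvergesToBenford B fun R =>
      lengthsAfter L (fun v => cut R v ω) (fun v => status R v ω) (N R) := by
  have hpos : ∀ᵐ ω ∂μ, ∀ R, ∀ v, ∀ i : Fin k, 0 < gap (cut R v ω) i := by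
    refine ae_all_iff.mpr fun R => ae_all_iff.mpr fun v => ae_all_iff.mpr fun i => ?_
    have := hD.ae_gap_pos (i := i) (by omega)
    rw [← (hproc R).law_cut v] at this
    exact ae_of_ae_map ((hproc R).measurable_cut v).aemeasurable this
  -- Tolerances `1 / (q + 1)` keep the number of almost sure events countable.
  have hsum : ∀ᵐ ω ∂μ, ∀ n : {n : ℤ // n ≠ 0}, ∀ q : ℕ, ∀ᶠ R in atTop,
      ‖∑ v ∈ sticksAfter (fun v => status R v ω) (N R),
        pathProd (fun w => charWeight k B n (cut R w ω)) v‖ ≤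
      1 / ((q : ℝ) + 1) * (sticksAfter (fun v => status R v ω) (N R)).card :=
    ae_all_iff.mpr fun n => ae_all_iff.mpr fun q =>
      ae_eventually_norm_sum_pathProd_le hk hD hproc hN hB n.2 (by positivity)
  filter_upwards [hpos, hsum] with ω hpos hsum
  have hne : ∀ᶠ R in atTop, (sticksAfter (fun v => status R v ω) (N R)).Nonempty := by
    filter_upwards [eventually_ge_atTop 1] with R hR
    exact Finset.card_pos.mp (hR.trans (le_card_sticksAfter hk _ _))
  refine convergesToBenford_of_logChar hB hne
    (X := fun R => stickLength L fun v => cut R v ω)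
    (fun R v => stickLength_pos hL (hpos R) v) fun n hn => ?_
  rw [Metric.tendsto_atTop']
  intro ε hε
  obtain ⟨q, hq⟩ := exists_nat_one_div_lt hε
  obtain ⟨R₀, hR₀⟩ := eventually_atTop.mp ((hsum ⟨n, hn⟩ q).and hne)
  refine ⟨R₀, fun R hR => ?_⟩
  obtain ⟨h1, h2⟩ := hR₀ R hR.le
  have hc : (0 : ℝ) < (sticksAfter (fun v => status R v ω) (N R)).card := by
    exact_mod_cast h2.card_pos
  simp only [logChar_stickLength hL (hpos R), ← Finset.mul_sum]
  rw [dist_zero_right, norm_div, norm_mul, norm_logChar, one_mul, Complex.norm_natCast,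
    div_lt_iff₀ hc]
  exact h1.trans_lt (mul_lt_mul_of_pos_right hq hc)

/-! ### Convergence of the mean and of the variance -/

lemma proportion_nonneg (B s : ℝ) (A : Multiset ℝ) : 0 ≤ proportion B s A := by
  unfold proportion
  positivity

lemma proportion_le_one (B s : ℝ) (A : Multiset ℝ) : proportion B s A ≤ 1 := by
  classical
  unfold proportion
  refine div_le_one_of_le₀ ?_ (Nat.cast_nonneg _)
  exact_mod_cast Multiset.card_le_card (Multiset.filter_le _ _)

lemma measurable_significand (B : ℝ) : Measurable (significand B) := by
  have h1 : Measurable fun x : ℝ => ⌊Real.logb B x⌋ :=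
    Int.measurable_floor.comp (Real.measurable_log.div_const _)
  exact measurable_id.div ((measurable_of_countable fun n : ℤ => B ^ n).comp h1)

lemma measurable_stickLength {R : ℕ} {cut : Stick R k → Ω → Fin (k - 1) → ℝ}
    (hcut : ∀ v, Measurable (cut v)) (L : ℝ) (v : Stick R k) :
    Measurable fun ω => stickLength L (fun v => cut v ω) v := by
  obtain ⟨j, l⟩ := v
  induction l with
  | nil =>
    simp only [stickLength]
    exact measurable_const
  | cons i l ih =>
    simp only [stickLength]
    exact ih.mul ((measurable_gap _).comp (hcut _))

lemma measurable_proportion_lengthsAfter {R : ℕ} {cut : Stick R k → Ω → Fin (k - 1) → ℝ}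
    {status : Stick R k → Ω → Fin k → Bool} (hcut : ∀ v, Measurable (cut v))
    (hstatus : ∀ v, Measurable (status v)) (B s L : ℝ) (N : ℕ) :
    Measurable fun ω =>
      proportion B s (lengthsAfter L (fun v => cut v ω) (fun v => status v ω) N) := by
  classical
  have hV : ∀ V : Finset (Stick R k), Measurable fun ω =>
      proportion B s (V.val.map (stickLength L fun v => cut v ω)) := by
    intro V
    have : ∀ ω, proportion B s (V.val.map (stickLength L fun v => cut v ω)) =
        (∑ v ∈ V, if significand B (stickLength L (fun v => cut v ω) v) ≤ s then (1 : ℝ) else 0) /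
          V.card := by
      intro ω
      rw [proportion, Multiset.filter_map, Multiset.card_map, Multiset.card_map, Finset.sum_boole]
      rfl
    simp only [this]
    refine (Finset.measurable_fun_sum _ fun v _ => Measurable.ite ?_ measurable_const
      measurable_const).div_const _
    exact measurableSet_le ((measurable_significand B).comp (measurable_stickLength hcut L v))
      measurable_const
  intro S hS
  -- The random index set takes countably many values, and on each of them the proportion is a
  -- finite sum.
  have : (fun ω => proportion B s (lengthsAfter L (fun v => cut v ω) (fun v => status v ω) N)) ⁻¹'
      S = ⋃ V, {ω | sticksAfter (fun v => status v ω) N = V} ∩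
        (fun ω => proportion B s (V.val.map (stickLength L fun v => cut v ω))) ⁻¹' S := by
    ext ω
    simp only [lengthsAfter, Set.mem_preimage, Set.mem_iUnion, Set.mem_inter_iff,
      Set.mem_ofPred_eq, exists_eq_left']
  rw [this]
  exact MeasurableSet.iUnion fun V => (measurableSet_sticksAfter_eq hstatus N V).inter (hV V hS)

/-- Proportions lie in `[0, 1]`, so dominated convergence applies to them and to their squares. -/
lemma randomConvergesToBenford_of_ae [IsProbabilityMeasure μ] {B : ℝ} {A : ℕ → Ω → Multiset ℝ}
    (hA : ∀ s n, Measurable fun ω => proportion B s (A n ω))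
    (h : ∀ᵐ ω ∂μ, ConvergesToBenford B fun n => A n ω) : RandomConvergesToBenford B μ A := by
  intro s hs
  have hb : ∀ n ω, ‖proportion B s (A n ω)‖ ≤ 1 := fun n ω => by
    rw [Real.norm_eq_abs, abs_of_nonneg (proportion_nonneg _ _ _)]
    exact proportion_le_one _ _ _
  have h1 : Tendsto (fun n => ∫ ω, proportion B s (A n ω) ∂μ) atTop (𝓝 (Real.logb B s)) := by
    have := tendsto_integral_of_dominated_convergence (μ := μ) (fun _ => 1)
      (fun n => (hA s n).aestronglyMeasurable) (integrable_const 1)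
      (fun n => ae_of_all _ (hb n)) (h.mono fun ω hω => hω s hs)
    simpa using this
  have h2 : Tendsto (fun n => ∫ ω, proportion B s (A n ω) ^ 2 ∂μ) atTop
      (𝓝 (Real.logb B s ^ 2)) := by
    have := tendsto_integral_of_dominated_convergence (μ := μ) (fun _ => 1)
      (fun n => ((hA s n).pow_const 2).aestronglyMeasurable) (integrable_const 1)
      (fun n => ae_of_all _ fun ω => by
        rw [norm_pow]
        exact pow_le_one₀ (norm_nonneg _) (hb n ω))
      (h.mono fun ω hω => (hω s hs).pow 2)
    simpa using this
  refine ⟨h1, ?_⟩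
  have h3 := h2.sub (h1.pow 2)
  rw [sub_self] at h3
  refine h3.congr fun n => ?_
  rw [variance_eq_sub (MemLp.of_bound (hA s n).aestronglyMeasurable 1 (ae_of_all _ (hb n)))]
  rfl

end StickBreaking

theorem mainTheorem6 {Ω : Type*} [MeasurableSpace Ω] (μ : Measure Ω) [IsProbabilityMeasure μ]
    (B : ℝ) (hB : 1 < B) (L : ℝ) (hL : 0 < L) (k : ℕ) (hk : 2 ≤ k)
    (D : Measure (Fin (k - 1) → ℝ)) [IsProbabilityMeasure D] (hD : StickBreaking.IsGood D)
    (cut : ∀ R : ℕ, StickBreaking.Stick R k → Ω → Fin (k - 1) → ℝ)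
    (status : ∀ R : ℕ, StickBreaking.Stick R k → Ω → Fin k → Bool)
    (hproc : ∀ R : ℕ, StickBreaking.IsFragmentation μ D (1 / (k : ℝ)) (cut R) (status R))
    (N : ℕ → ℕ) (hN : ∀ R : ℕ, Real.log (R : ℝ) ≤ (N R : ℝ)) :
    StickBreaking.RandomConvergesToBenford B μ
      (fun R ω => StickBreaking.lengthsAfter L (fun v => cut R v ω) (fun v => status R v ω) (N R)) ∧
    ∀ᵐ ω ∂μ, StickBreaking.ConvergesToBenford B
      (fun R => StickBreaking.lengthsAfter L (fun v => cut R v ω) (fun v => status R v ω) (N R)) := by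
  -- The logarithmic growth enters through `N R → ∞`: eventually `N R` exceeds each fixed number `M`
  -- of generations.
  have hNtop : Tendsto N atTop atTop := by
    have hlog : Tendsto (fun R : ℕ => Real.log (R : ℝ)) atTop atTop :=
      Real.tendsto_log_atTop.comp tendsto_natCast_atTop_atTop
    exact tendsto_natCast_atTop_iff.mp (tendsto_atTop_mono hN hlog)
  have hae := StickBreaking.ae_convergesToBenford hk hD hproc hNtop hB hL
  exact ⟨StickBreaking.randomConvergesToBenford_of_ae (fun s R =>
    StickBreaking.measurable_proportion_lengthsAfter (hproc R).measurable_cut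
      (hproc R).measurable_status B s L (N R)) hae, hae⟩
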